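/- Let $\mathbb{H}$ be the real algebra of quaternions, $\mathbb{S}=\{I\in\mathbb{H}: I^2=-1\}$, and for $I\in\mathbb{S}$ let $L_I=\mathbb{R}+I\mathbb{R}$. Let $\widehat{\mathbb{H}}=\mathbb{H}\cup\{\infty\}$ be the Alexandroff compactification of $\mathbb{H}$ and $\widehat{\mathbb{R}}=\mathbb{R}\cup\{\infty\}$. A real differentiable function $f$ on a domain $\Omega\subseteq\mathbb{H}$ is *regular* if $\frac12\left(\frac{\partial}{\partial x}+I\frac{\partial}{\partial y}\right)f(x+Iy)=0$ for all $I\in\mathbb{S}$ and all $x+Iy\in\Omega$. If $p\in L_I$ and $\Omega$ contains a punctured disc $\{z\in L_I: 0<|z-p|<R\}$, then $f(z)=\sum_{n\in\mathbb{Z}}(z-p)^na_n$ on it for some $a_n\in\mathbb{H}$; the singularity $p$ is *non-essential* if only finitely many $a_n$ with $n<0$ are nonzero, and it is a *pole* (of positive order) if moreover at least one of them is nonzero; for $p\in\mathbb{R}$ this is required for every $I\in\mathbb{S}$. The point $\infty$ is a pole of $f$ if $0$ is a pole of $q\mapsto f(q^{-1})$. A function $f$ is *semiregular in $\mathbb{H}$*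 if it is regular on a domain $\Omega\subseteq\mathbb{H}$ such that every point $p$ of $\mathbb{H}\setminus\Omega$ is a non-essential singularity of $f$ (in particular isolated within each $L_I\ni p$). For power series $f(q)=\sum_n q^na_n$ and $g(q)=\sum_n q^nb_n$ converging on $\mathbb{H}$, put $f*g(q)=\sum_n q^n\sum_{k=0}^n a_kb_{n-k}$, $f^c(q)=\sum_n q^n\bar a_n$, $f^s=f*f^c$, and, if $f\not\equiv 0$, $f^{-*}*g(q)=f^s(q)^{-1}\,(f^c*g)(q)$ wherever $f^s(q)\ne0$. For $A=\begin{pmatrix}a&c\\ b&d\end{pmatrix}\in GL(2,\mathbb{H})$, the *regular fractional transformation* associated to $A$ is $\mathcal{F}_A(q)=(qc+d)^{-*}*(qa+b)$, and the *linear fractional transformation* associated to $A$ is $F_A:\widehat{\mathbb{H}}\to\widehat{\mathbb{H}}$, $F_A(q)=(qc+d)^{-1}(qa+b)$, where $F_A(\infty)=\infty$ if $c=0$, and $F_A(-dc^{-1})=\infty$, $F_A(\infty)=c^{-1}a$ if $c\neq0$. Let $\mathcal{G}=\{\mathcal{F}_A: A\in GL(2,\mathbb{H})\}$ and $\mathbb{G}=\{F_A: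 A\in GL(2,\mathbb{H})\}$. A semiregular function $f$ is identified with $\mathcal{F}_A$ if the two agree wherever both are defined, and with $F_A$ if $F_A$ extends $f$. **Corollary.** Let $f$ be semiregular in $\mathbb{H}$. The following are equivalent: 1. $f$ extends to a homeomorphism from $\widehat{\mathbb{H}}$ onto itself; 2. $f$ extends to a continuous, injective map $\widehat{\mathbb{H}}\to\widehat{\mathbb{H}}$; 3. $f$ is a regular fractional transformation $\mathcal{F}_A$ having a pole in $\widehat{\mathbb{R}}$; 4. $f\in\mathcal{G}\cap\mathbb{G}$. -/

import Mathlib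

open scoped Quaternion

namespace SliceRegular

noncomputable section

/-- The sphere `𝕊` of quaternionic imaginary units. -/
def imagUnits : Set ℍ[ℝ] := {I | I ^ 2 = -1}

/-- The complex line `L_I = ℝ + Iℝ`. -/
def slice (I : ℍ[ℝ]) : Set ℍ[ℝ] := {q | ∃ x y : ℝ, q = (x : ℍ[ℝ]) + I * (y : ℍ[ℝ])}

/-- The operator `∂̄_I f (x + Iy) = ½ (∂/∂x + I ∂/∂y) f_I (x + Iy)`. -/
def dbar (I : ℍ[ℝ]) (f : ℍ[ℝ] → ℍ[ℝ]) (x y : ℝ) : ℍ[ℝ] :=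
  (1 / 2 : ℝ) •
    (deriv (fun s : ℝ => f ((s : ℍ[ℝ]) + I * (y : ℍ[ℝ]))) x +
      I * deriv (fun t : ℝ => f ((x : ℍ[ℝ]) + I * (t : ℍ[ℝ]))) y)

/-- `f` is regular on the domain `Ω`. Only the values of `f` on `Ω` matter. -/
structure IsRegularOn (Ω : Set ℍ[ℝ]) (f : ℍ[ℝ] → ℍ[ℝ]) : Prop where
  isOpen : IsOpen Ω
  isConnected : IsConnected Ω
  differentiable : DifferentiableOn ℝ f Ω
  dbar_eq_zero : ∀ I ∈ imagUnits, ∀ x y : ℝ,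
    (x : ℍ[ℝ]) + I * (y : ℍ[ℝ]) ∈ Ω → dbar I f x y = 0

/-- `Ω` contains the punctured disc of radius `R` about `p` in `L_I`, and on it
`f_I(z) = ∑_{n ∈ ℤ} (z - p)^n a_n`. -/
def HasLaurentExpansion (Ω : Set ℍ[ℝ]) (f : ℍ[ℝ] → ℍ[ℝ]) (I p : ℍ[ℝ]) (R : ℝ)
    (a : ℤ → ℍ[ℝ]) : Prop :=
  0 < R ∧ ∀ z ∈ slice I, z ≠ p → ‖z - p‖ < R →
    z ∈ Ω ∧ HasSum (fun n : ℤ => (z - p) ^ n * a n) (f z)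

/-- `p` is an isolated singularity of `f` in each complex line through `p`, and it is not
essential: the Laurent expansion at `p` has finite principal part (possibly zero, i.e. poles
of order `0` are allowed). -/
def IsNonessentialAt (Ω : Set ℍ[ℝ]) (f : ℍ[ℝ] → ℍ[ℝ]) (p : ℍ[ℝ]) : Prop :=
  ∀ I ∈ imagUnits, p ∈ slice I → ∃ (R : ℝ) (a : ℤ → ℍ[ℝ]) (N : ℕ),
    HasLaurentExpansion Ω f I p R a ∧ ∀ m : ℕ, N < m → a (-(m : ℤ)) = 0

/-- `p` is a pole of `f` of positive order: the Laurent expansion at `p` in each complex line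
through `p` has finite and nonzero principal part. -/
def HasPoleAt (Ω : Set ℍ[ℝ]) (f : ℍ[ℝ] → ℍ[ℝ]) (p : ℍ[ℝ]) : Prop :=
  ∀ I ∈ imagUnits, p ∈ slice I → ∃ (R : ℝ) (a : ℤ → ℍ[ℝ]) (N : ℕ),
    HasLaurentExpansion Ω f I p R a ∧ (∀ m : ℕ, N < m → a (-(m : ℤ)) = 0) ∧
      ∃ m : ℕ, 0 < m ∧ a (-(m : ℤ)) ≠ 0

/-- `∞` is a pole of `f`: the function `q ↦ f(q⁻¹)` has a pole at `0`. -/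
def HasPoleAtInfty (Ω : Set ℍ[ℝ]) (f : ℍ[ℝ] → ℍ[ℝ]) : Prop :=
  HasPoleAt {q | q ≠ 0 ∧ q⁻¹ ∈ Ω} (fun q => f q⁻¹) 0

/-- `f`, with domain of definition `Ω`, is semiregular in `ℍ`: it is regular on `Ω` and no
point of `ℍ` outside `Ω` is an essential singularity. -/
structure IsSemiregular (Ω : Set ℍ[ℝ]) (f : ℍ[ℝ] → ℍ[ℝ]) : Prop where
  isRegularOn : IsRegularOn Ω f
  nonessential : ∀ p, p ∉ Ω → IsNonessentialAt Ω f p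

/-- The value `∑ q^n a_n` of the series with coefficients `a_n`. The product of
`PowerSeries ℍ[ℝ]`, with coefficients `∑_{k ≤ n} a_k b_{n-k}`, is the regular product `*`. -/
def evalSeries (f : PowerSeries ℍ[ℝ]) (q : ℍ[ℝ]) : ℍ[ℝ] :=
  ∑' n : ℕ, q ^ n * PowerSeries.coeff n f

/-- The regular conjugate `f^c`. -/
def regConj (f : PowerSeries ℍ[ℝ]) : PowerSeries ℍ[ℝ] :=
  PowerSeries.mk fun n => star (PowerSeries.coeff n f)

/-- The symmetrization `f^s = f * f^c`. -/
def symmetrization (f : PowerSeries ℍ[ℝ]) : PowerSeries ℍ[ℝ] := f * regConj f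

/-- The domain of definition of the regular quotients with denominator `f`: the complement of
the zero set of `f^s`. -/
def regQuotDomain (f : PowerSeries ℍ[ℝ]) : Set ℍ[ℝ] :=
  {q | evalSeries (symmetrization f) q ≠ 0}

/-- The regular quotient `f^{-*} * g = (1 / f^s) (f^c * g)`, considered on `regQuotDomain f`. -/
def regQuot (f g : PowerSeries ℍ[ℝ]) (q : ℍ[ℝ]) : ℍ[ℝ] :=
  (evalSeries (symmetrization f) q)⁻¹ * evalSeries (regConj f * g) q

/-- The regular function `q ↦ q a + b`, as a power series. -/
def affineSeries (a b : ℍ[ℝ]) : PowerSeries ℍ[ℝ] :=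
  PowerSeries.X * PowerSeries.C a + PowerSeries.C b

/-- The group `GL(2, ℍ)`; its elements are written `(a c; b d)`, so that `a = A 0 0`,
`c = A 0 1`, `b = A 1 0`, `d = A 1 1`. -/
abbrev GL2H : Type := (Matrix (Fin 2) (Fin 2) ℍ[ℝ])ˣ

/-- The domain of definition of the regular fractional transformation of `A`. -/
def regFracDomain (A : GL2H) : Set ℍ[ℝ] :=
  regQuotDomain (affineSeries (A.val 0 1) (A.val 1 1))

/-- The regular fractional transformation `(qc+d)^{-*} * (qa+b)`. -/
def regFrac (A : GL2H) : ℍ[ℝ] → ℍ[ℝ] :=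
  regQuot (affineSeries (A.val 0 1) (A.val 1 1)) (affineSeries (A.val 0 0) (A.val 1 0))

open Classical in
/-- The linear fractional transformation `(qc+d)⁻¹(qa+b)` of `ℍ ∪ {∞}`. -/
def linFrac (A : GL2H) : OnePoint ℍ[ℝ] → OnePoint ℍ[ℝ]
  | none =>
      if A.val 0 1 = 0 then OnePoint.infty
      else (((A.val 0 1)⁻¹ * A.val 0 0 : ℍ[ℝ]) : OnePoint ℍ[ℝ])
  | some q =>
      if q * A.val 0 1 + A.val 1 1 = 0 then OnePoint.infty
      else (((q * A.val 0 1 + A.val 1 1)⁻¹ * (q * A.val 0 0 + A.val 1 0) : ℍ[ℝ]) :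
        OnePoint ℍ[ℝ])

/-- `φ : ℍ ∪ {∞} → ℍ ∪ {∞}` extends the function `f` with domain of definition `Ω`. -/
def Extends (Ω : Set ℍ[ℝ]) (f : ℍ[ℝ] → ℍ[ℝ]) (φ : OnePoint ℍ[ℝ] → OnePoint ℍ[ℝ]) : Prop :=
  ∀ q ∈ Ω, φ (q : OnePoint ℍ[ℝ]) = ((f q : ℍ[ℝ]) : OnePoint ℍ[ℝ])

/-- `f` (with domain of definition `Ω`) is the regular fractional transformation of `A`:
as usual for functions with poles and removable singularities, two of them are the same when
they agree wherever both are defined. -/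
def EqRegFrac (Ω : Set ℍ[ℝ]) (f : ℍ[ℝ] → ℍ[ℝ]) (A : GL2H) : Prop :=
  ∀ q ∈ Ω ∩ regFracDomain A, f q = regFrac A q

/-- `f` belongs to the set `𝒢` of regular fractional transformations. -/
def MemRegFrac (Ω : Set ℍ[ℝ]) (f : ℍ[ℝ] → ℍ[ℝ]) : Prop := ∃ A : GL2H, EqRegFrac Ω f A

/-- `f` belongs to the group `𝔾` of linear fractional transformations. -/
def MemLinFrac (Ω : Set ℍ[ℝ]) (f : ℍ[ℝ] → ℍ[ℝ]) : Prop := ∃ A : GL2H, Extends Ω f (linFrac A)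

/-- `f` is a regular fractional transformation with pole in `ℝ ∪ {∞}`. The pole is taken in the
natural domain of the transformation. -/
def IsRegFracWithRealPole (Ω : Set ℍ[ℝ]) (f : ℍ[ℝ] → ℍ[ℝ]) : Prop :=
  ∃ A : GL2H, EqRegFrac Ω f A ∧
    ((∃ x : ℝ, HasPoleAt (regFracDomain A) (regFrac A) (x : ℍ[ℝ])) ∨
      HasPoleAtInfty (regFracDomain A) (regFrac A))

end

end SliceRegular

/-!
The heart of the matter is `2 → 3`. A continuous injective extension `φ` of `f` to `ℍ ∪ {∞}` takes
the value `∞`, for otherwise it would be bounded and Liouville's theorem on a complex line would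
make it constant there. If `φ p = ∞` with `p` finite, then every complex line contains `p`, since
the representation formula expresses `φ` on any complex line by its values on any other one; hence
`p` is real. Precomposing with `q ↦ p + q⁻¹` moves the pole to `∞`.

Let now `g` be entire, injective and tending to `∞` at `∞`. For real `x`, the symmetrization of
`g - g x` restricts to an entire function on a complex line, which tends to `∞` at `∞` and vanishes
only at `x`: it is a polynomial `C (z - x) ^ m`. On the real line its values are `|g t - g x| ^ 2`,
so that `|g t - g x| = c |t - x| ^ n` with `c` and `n` depending on `x`. Symmetry in `x`, `t` and
the triangle inequality make `c` constant and `n = 1`; hence `g` is affine on `ℝ`, and the identity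
principle on each complex line gives `g q = q a + b`.

The two notions of fractional transformation meet because `(qc+d)^{-*} * (qa+b)` and
`(qc+d)⁻¹(qa+b)` agree at every `q` that commutes with `c` and `d`, in particular at real `q`: so a
real pole of the first is a pole of the second, and after multiplication on the left by a scalar `c`
and `d` become real, so that the two functions coincide everywhere.
-/

namespace SliceRegular

open Asymptotics Bornology Filter Topology ComplexConjugate Matrix

noncomputable section

theorem isBounded_range_of_isBigO_one {f : ℂ → ℂ} (hf : Continuous f)
    (h : f =O[cobounded ℂ] (fun _ => (1 : ℂ))) : IsBounded (Set.range f) := by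
  obtain ⟨C, hC⟩ := h.bound
  have hlarge : IsBounded {z | ‖f z‖ ≤ C * ‖(1 : ℂ)‖}ᶜ := by
    rwa [isBounded_def, compl_compl]
  have hcompact := (hlarge.isCompact_closure.image hf).isBounded
  refine (hcompact.union (Metric.isBounded_closedBall (x := 0) (r := C))).subset ?_
  rintro _ ⟨z, rfl⟩
  by_cases hz : ‖f z‖ ≤ C * ‖(1 : ℂ)‖
  · exact .inr (by simpa using hz)
  · exact .inl ⟨z, subset_closure hz, rfl⟩

theorem exists_polynomial_of_isBigO_pow {n : ℕ} {f : ℂ → ℂ} (hf : Differentiable ℂ f)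
    (hn : f =O[cobounded ℂ] (· ^ n)) : ∃ p : Polynomial ℂ, ∀ z, f z = p.eval z := by
  induction n generalizing f with
  | zero =>
    obtain ⟨c, hc⟩ := hf.exists_const_forall_eq_of_bounded
      (isBounded_range_of_isBigO_one hf.continuous (by simpa only [pow_zero] using hn))
    exact ⟨.C c, fun z => by rw [hc z, Polynomial.eval_C]⟩
  | succ n ih =>
    have hd : Differentiable ℂ (dslope f 0) := by
      rw [← differentiableOn_univ] at hf ⊢
      exact (Complex.differentiableOn_dslope univ_mem).2 hf
    have hslope : dslope f 0 =O[cobounded ℂ] (· ^ n) := by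
      have hconst : (fun _ => f 0) =O[cobounded ℂ] (fun z : ℂ => z ^ (n + 1)) :=
        (isLittleO_const_left.2 <| .inr <| tendsto_norm_cobounded_atTop.comp <|
          tendsto_pow_cobounded_cobounded n.succ_ne_zero).isBigO
      have hquot := (isBigO_refl (fun z : ℂ => z⁻¹) (cobounded ℂ)).mul (hn.sub hconst)
      refine hquot.congr' ?_ ?_ <;>
        filter_upwards [eventually_ne_cobounded (0 : ℂ)] with z hz
      · rw [dslope_of_ne f hz, slope_def_field, sub_zero, div_eq_inv_mul]
      · rw [pow_succ', inv_mul_cancel_left₀ hz]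
    obtain ⟨p, hp⟩ := ih hd hslope
    refine ⟨.C (f 0) + .X * p, fun z => ?_⟩
    simpa [← hp z, sub_eq_iff_eq_add'] using (sub_smul_dslope f 0 z).symm

/-- In the coordinate at infinity `1 / f(1 / w)` has a removable singularity, hence a zero of
finite order `n`, so that `f z = O(z ^ n)`. -/
theorem exists_polynomial_of_tendsto_cobounded {f : ℂ → ℂ} (hf : Differentiable ℂ f)
    (h : Tendsto f (cobounded ℂ) (cobounded ℂ)) : ∃ p : Polynomial ℂ, ∀ z, f z = p.eval z := by
  have hinv : Tendsto (fun w : ℂ => f w⁻¹) (𝓝[≠] 0) (cobounded ℂ) :=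
    h.comp tendsto_inv₀_nhdsNE_zero
  have hne : ∀ᶠ w : ℂ in 𝓝[≠] 0, f w⁻¹ ≠ 0 := hinv.eventually_ne_cobounded 0
  set g : ℂ → ℂ := Function.update (fun w => (f w⁻¹)⁻¹) 0 0
  have hgf {w : ℂ} (hw : w ≠ 0) : g w = (f w⁻¹)⁻¹ := Function.update_of_ne hw _ _
  have hg : AnalyticAt ℂ g 0 := by
    refine Complex.analyticAt_of_differentiable_on_punctured_nhds_of_continuousAt ?_
      (continuousAt_update_same.2 (tendsto_inv₀_cobounded.comp hinv))
    filter_upwards [hne, self_mem_nhdsWithin] with w hfw hw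
    refine DifferentiableAt.congr_of_eventuallyEq (f := fun w => (f w⁻¹)⁻¹) ?_
      ((eventually_ne_nhds hw).mono fun v hv => hgf hv)
    exact ((hf w⁻¹).comp w (differentiableAt_inv hw)).inv hfw
  obtain ⟨n, u, hu, hu0, hgu⟩ := hg.exists_eventuallyEq_pow_smul_nonzero_iff.2 fun hg0 => by
    obtain ⟨w, ⟨hfw, hgw⟩, hw⟩ :=
      ((hne.and (hg0.filter_mono nhdsWithin_le_nhds)).and self_mem_nhdsWithin).exists
    exact inv_ne_zero hfw ((hgf hw).symm.trans hgw)
  have hfu : (fun w => w⁻¹ ^ n * (u w)⁻¹) =ᶠ[𝓝[≠] 0] fun w => f w⁻¹ := by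
    filter_upwards [hgu.filter_mono nhdsWithin_le_nhds, self_mem_nhdsWithin] with w hgw hw
    rw [← inv_inv (f w⁻¹), ← hgf hw, hgw, sub_zero, smul_eq_mul, mul_inv, inv_pow]
  have hbdd : (fun w => (u w)⁻¹) =O[𝓝[≠] 0] fun _ => (1 : ℂ) :=
    ((hu.continuousAt.inv₀ hu0).isBigO_one ℂ).mono nhdsWithin_le_nhds
  have hbigO : (fun w => f w⁻¹) =O[𝓝[≠] 0] fun w => w⁻¹ ^ n :=
    ((isBigO_refl (fun w => w⁻¹ ^ n) _).mul hbdd).congr' hfu (.of_forall fun _ => mul_one _)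
  exact exists_polynomial_of_isBigO_pow (n := n) hf (by
    simpa only [Function.comp_def, inv_inv] using hbigO.comp_tendsto tendsto_inv₀_cobounded')

theorem exists_eq_const_mul_pow_of_tendsto_cobounded {f : ℂ → ℂ} (hf : Differentiable ℂ f)
    (h : Tendsto f (cobounded ℂ) (cobounded ℂ)) {x : ℂ} (hx : ∀ z, f z = 0 → z = x) :
    ∃ (c : ℂ) (n : ℕ), c ≠ 0 ∧ ∀ z, f z = c * (z - x) ^ n := by
  obtain ⟨p, hp⟩ := exists_polynomial_of_tendsto_cobounded hf h
  have hp0 : p ≠ 0 := by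
    rintro rfl
    exact (h.eventually_ne_cobounded 0).exists.elim fun z hz => hz (by simp [hp])
  have hroots : p.roots = Multiset.replicate p.natDegree x := by
    rw [Multiset.eq_replicate, (IsAlgClosed.splits p).natDegree_eq_card_roots]
    exact ⟨rfl, fun z hz => hx z <| (hp z).trans (Polynomial.isRoot_of_mem_roots hz)⟩
  refine ⟨p.leadingCoeff, p.natDegree, Polynomial.leadingCoeff_ne_zero.2 hp0, fun z => ?_⟩
  conv_lhs => rw [hp, (IsAlgClosed.splits p).eq_prod_roots, hroots]
  simp

theorem tendsto_of_hasSum_pow_smul {𝕜 E : Type*} [NontriviallyNormedField 𝕜]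
    [NormedAddCommGroup E] [NormedSpace 𝕜 E] {F : 𝕜 → E} {z₀ : 𝕜} {c : ℕ → E}
    (h : ∀ᶠ z in 𝓝[≠] z₀, HasSum (fun n => (z - z₀) ^ n • c n) (F z)) :
    Tendsto F (𝓝[≠] z₀) (𝓝 (c 0)) := by
  classical
  set p : FormalMultilinearSeries 𝕜 𝕜 E := fun n => .mkPiRing 𝕜 (Fin n) (c n)
  have hp (n : ℕ) : p.coeff n = c n := by simp [p, FormalMultilinearSeries.coeff]
  have hpow : HasFPowerSeriesAt (Function.update F z₀ (c 0)) p z₀ := by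
    simp only [hasFPowerSeriesAt_iff', hp]
    refine eventually_nhdsWithin_iff.1 h |>.mono fun z hz => ?_
    obtain rfl | hne := eq_or_ne z z₀
    · simpa using hasSum_single (f := fun n => (z - z) ^ n • c n) 0 (by simp +contextual)
    · simpa only [Function.update_of_ne hne] using hz hne
  exact continuousAt_update_same.1 hpow.continuousAt

theorem mem_imagUnits_iff {I : ℍ[ℝ]} : I ∈ imagUnits ↔ I * I = -1 := by
  rw [← sq]; rfl

theorem imagUnit_mul_self (I : imagUnits) : (I : ℍ[ℝ]) * I = -1 := mem_imagUnits_iff.1 I.2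

instance : Neg imagUnits :=
  ⟨fun I => ⟨-I, mem_imagUnits_iff.2 ((neg_mul_neg _ _).trans (imagUnit_mul_self I))⟩⟩

theorem coe_neg_imagUnit (I : imagUnits) : ((-I : imagUnits) : ℍ[ℝ]) = -I := rfl

theorem norm_imagUnit (I : imagUnits) : ‖(I : ℍ[ℝ])‖ = 1 := by
  have h : ‖(I : ℍ[ℝ])‖ * ‖(I : ℍ[ℝ])‖ = 1 := by
    rw [← norm_mul, imagUnit_mul_self, norm_neg, norm_one]
  nlinarith [norm_nonneg (I : ℍ[ℝ])]

theorem star_imagUnit (I : imagUnits) : star (I : ℍ[ℝ]) = -I := by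
  rw [Quaternion.star_eq_neg, ← Quaternion.sq_eq_neg_normSq, sq, imagUnit_mul_self,
    Quaternion.normSq_eq_norm_mul_self, norm_imagUnit, mul_one, Quaternion.coe_one]

/-- The embedding `x + iy ↦ x + Iy` of `ℂ` onto the complex line `L_I`. -/
def sliceEmb (I : imagUnits) : ℂ →ₐ[ℝ] ℍ[ℝ] :=
  Complex.lift ⟨I, imagUnit_mul_self I⟩

theorem sliceEmb_apply (I : imagUnits) (z : ℂ) : sliceEmb I z = z.re + I * z.im := by
  rw [Quaternion.mul_coe_eq_smul]; rfl

theorem sliceEmb_I (I : imagUnits) : sliceEmb I Complex.I = I := by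
  simp [sliceEmb_apply]

theorem sliceEmb_ofReal (I : imagUnits) (x : ℝ) : sliceEmb I x = x :=
  (sliceEmb I).map_coe_real_complex x

theorem sliceEmb_neg (I : imagUnits) (z : ℂ) : sliceEmb (-I) z = sliceEmb I (conj z) := by
  simp [sliceEmb_apply, coe_neg_imagUnit]

theorem star_sliceEmb (I : imagUnits) (z : ℂ) : star (sliceEmb I z) = sliceEmb I (conj z) := by
  simp only [sliceEmb_apply, star_add, star_mul, star_imagUnit, Quaternion.star_coe,
    Complex.conj_re, Complex.conj_im, Quaternion.coe_neg, mul_neg,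
    (Quaternion.coe_commute z.im (I : ℍ[ℝ])).eq]

theorem norm_sliceEmb (I : imagUnits) (z : ℂ) : ‖sliceEmb I z‖ = ‖z‖ := by
  have h : sliceEmb I z * star (sliceEmb I z) = (Complex.normSq z : ℝ) := by
    rw [star_sliceEmb, ← map_mul, Complex.mul_conj, sliceEmb_ofReal]
  rw [Quaternion.self_mul_star, Quaternion.coe_inj, Quaternion.normSq_eq_norm_mul_self,
    Complex.normSq_eq_norm_sq, ← sq] at h
  exact (sq_eq_sq₀ (norm_nonneg _) (norm_nonneg _)).1 h

theorem isometry_sliceEmb (I : imagUnits) : Isometry (sliceEmb I) :=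
  AddMonoidHomClass.isometry_of_norm _ (norm_sliceEmb I)

theorem re_sliceEmb (I : imagUnits) (z : ℂ) : (sliceEmb I z).re = z.re := by
  have hI : (I : ℍ[ℝ]).re = 0 := Quaternion.star_eq_neg.1 (star_imagUnit I)
  simp [sliceEmb_apply, hI]

theorem mem_slice_iff {I : imagUnits} {q : ℍ[ℝ]} : q ∈ slice I ↔ ∃ z, sliceEmb I z = q :=
  ⟨fun ⟨x, y, h⟩ => ⟨⟨x, y⟩, by rw [h, sliceEmb_apply]⟩,
    fun ⟨z, h⟩ => ⟨z.re, z.im, by rw [← h, sliceEmb_apply]⟩⟩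

/-- The imaginary unit `i`. -/
def unitI : imagUnits := ⟨⟨0, 1, 0, 0⟩, mem_imagUnits_iff.2 <|
  (QuaternionAlgebra.mk_mul_mk ..).trans <| by ext <;> simp⟩

@[simp] theorem re_unitI : (unitI : ℍ[ℝ]).re = 0 := rfl

@[simp] theorem imI_unitI : (unitI : ℍ[ℝ]).imI = 1 := rfl

@[simp] theorem imJ_unitI : (unitI : ℍ[ℝ]).imJ = 0 := rfl

@[simp] theorem imK_unitI : (unitI : ℍ[ℝ]).imK = 0 := rfl

/-- The imaginary unit `j`. -/
def unitJ : imagUnits := ⟨⟨0, 0, 1, 0⟩, mem_imagUnits_iff.2 <|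
  (QuaternionAlgebra.mk_mul_mk ..).trans <| by ext <;> simp⟩

theorem exists_sliceEmb_eq (q : ℍ[ℝ]) : ∃ (I : imagUnits) (z : ℂ), sliceEmb I z = q := by
  obtain hq | hq := eq_or_ne q.im 0
  · exact ⟨unitI, q.re, by simpa [sliceEmb_ofReal, hq] using q.re_add_im⟩
  · have hn : ‖q.im‖ ≠ 0 := norm_ne_zero_iff.2 hq
    refine ⟨⟨‖q.im‖⁻¹ • q.im, mem_imagUnits_iff.2 ?_⟩, ⟨q.re, ‖q.im‖⟩, ?_⟩
    · rw [smul_mul_smul_comm, ← sq q.im, Quaternion.im_sq, Quaternion.normSq_eq_norm_mul_self,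
        smul_neg, ← Quaternion.coe_smul, smul_eq_mul, mul_mul_mul_comm, inv_mul_cancel₀ hn, one_mul,
        Quaternion.coe_one]
    · rw [sliceEmb_apply, Quaternion.mul_coe_eq_smul, smul_inv_smul₀ hn, Quaternion.re_add_im]

theorem eq_or_eq_conj_of_sliceEmb_eq {I J : imagUnits} {z w : ℂ}
    (h : sliceEmb I z = sliceEmb J w) : z = w ∨ z = conj w := by
  have hre : z.re = w.re := by rw [← re_sliceEmb I, h, re_sliceEmb]
  have hnorm : ‖z‖ = ‖w‖ := by rw [← norm_sliceEmb I, h, norm_sliceEmb]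
  have him : z.im ^ 2 = w.im ^ 2 := by
    have := congrArg (· ^ 2) hnorm
    simp only [← Complex.normSq_eq_norm_sq, Complex.normSq_apply, hre] at this
    linarith
  exact (sq_eq_sq_iff_eq_or_eq_neg.1 him).imp (Complex.ext hre) (Complex.ext hre)

/-- The structure of complex normed space on `ℍ` given by left multiplication by `L_I`. -/
@[reducible] def sliceNormedSpace (I : imagUnits) : NormedSpace ℂ ℍ[ℝ] where
  __ := Module.compHom ℍ[ℝ] (sliceEmb I).toRingHom
  norm_smul_le z q := by
    change ‖sliceEmb I z * q‖ ≤ ‖z‖ * ‖q‖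
    rw [norm_mul, norm_sliceEmb]

/-- Holomorphy of `g : ℂ → ℍ` at `z` when `i` acts on `ℍ` as left multiplication by `I`. -/
def HolomorphicAt (I : imagUnits) (g : ℂ → ℍ[ℝ]) (z : ℂ) : Prop :=
  letI := sliceNormedSpace I
  DifferentiableAt ℂ g z

section HolomorphicAt

variable {I J : imagUnits} {g h : ℂ → ℍ[ℝ]} {z : ℂ}

theorem isScalarTower_sliceNormedSpace (I : imagUnits) :
    letI := sliceNormedSpace I
    IsScalarTower ℝ ℂ ℍ[ℝ] :=
  letI := sliceNormedSpace I
  ⟨fun r z q => by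
    change sliceEmb I (r • z) * q = r • (sliceEmb I z * q)
    rw [map_smul, smul_mul_assoc]⟩

theorem apply_eq_sliceEmb_mul (L : ℂ →L[ℝ] ℍ[ℝ]) (hL : L Complex.I = I * L 1) (w : ℂ) :
    L w = sliceEmb I w * L 1 := by
  have hw : w = w.re • 1 + w.im • Complex.I := by simp
  rw [hw, map_add, map_smul, map_smul, hL, ← hw, sliceEmb_apply, add_mul,
    Quaternion.mul_coe_eq_smul, smul_mul_assoc, Quaternion.coe_mul_eq_smul]

theorem holomorphicAt_iff_cauchyRiemann :
    HolomorphicAt I g z ↔ DifferentiableAt ℝ g z ∧ fderiv ℝ g z Complex.I = I * fderiv ℝ g z 1 := by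
  let := sliceNormedSpace I
  have := isScalarTower_sliceNormedSpace I
  refine ⟨fun hg => ?_, fun ⟨hg, hCR⟩ => ?_⟩
  · have hg' : DifferentiableAt ℂ g z := hg
    refine ⟨hg'.restrictScalars ℝ, ?_⟩
    have := (fderiv ℂ g z).map_smul Complex.I 1
    rw [smul_eq_mul, mul_one] at this
    rw [hg'.fderiv_restrictScalars ℝ, ← sliceEmb_I]
    exact this
  · refine (differentiableAt_iff_restrictScalars ℝ hg).2 ⟨.toSpanSingleton ℂ (fderiv ℝ g z 1), ?_⟩
    ext1 w
    exact (apply_eq_sliceEmb_mul _ hCR w).symm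

protected theorem HolomorphicAt.continuousAt (hg : HolomorphicAt I g z) : ContinuousAt g z :=
  let := sliceNormedSpace I
  DifferentiableAt.continuousAt (𝕜 := ℂ) hg

theorem HolomorphicAt.sub (hg : HolomorphicAt I g z) (hh : HolomorphicAt I h z) :
    HolomorphicAt I (fun w => g w - h w) z :=
  let := sliceNormedSpace I
  DifferentiableAt.sub (𝕜 := ℂ) hg hh

theorem HolomorphicAt.add (hg : HolomorphicAt I g z) (hh : HolomorphicAt I h z) :
    HolomorphicAt I (fun w => g w + h w) z :=
  let := sliceNormedSpace I
  DifferentiableAt.add (𝕜 := ℂ) hg hh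

theorem holomorphicAt_const (a : ℍ[ℝ]) : HolomorphicAt I (fun _ => a) z :=
  let := sliceNormedSpace I
  differentiableAt_const (𝕜 := ℂ) a

theorem holomorphicAt_sliceEmb_mul (a : ℍ[ℝ]) : HolomorphicAt I (fun w => sliceEmb I w * a) z :=
  let := sliceNormedSpace I
  (differentiableAt_id (𝕜 := ℂ) (E := ℂ)).smul_const a

theorem HolomorphicAt.congr_of_eventuallyEq (hg : HolomorphicAt I g z) (hh : h =ᶠ[𝓝 z] g) :
    HolomorphicAt I h z :=
  let := sliceNormedSpace I
  DifferentiableAt.congr_of_eventuallyEq (𝕜 := ℂ) hg hh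

theorem HolomorphicAt.comp {u : ℂ → ℂ} (hg : HolomorphicAt I g (u z))
    (hu : DifferentiableAt ℂ u z) : HolomorphicAt I (g ∘ u) z :=
  let := sliceNormedSpace I
  DifferentiableAt.comp (𝕜 := ℂ) z hg hu

theorem HolomorphicAt.const_mul {T : ℍ[ℝ]} (hg : HolomorphicAt J g z) (hT : I * T = T * J) :
    HolomorphicAt I (fun w => T * g w) z := by
  rw [holomorphicAt_iff_cauchyRiemann] at hg ⊢
  refine ⟨hg.1.const_mul T, ?_⟩
  rw [fderiv_const_mul hg.1 T]
  simp [hg.2, ← mul_assoc, hT]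

theorem holomorphicAt_of_punctured (hg : ∀ᶠ w in 𝓝[≠] z, HolomorphicAt I g w)
    (hc : ContinuousAt g z) : HolomorphicAt I g z :=
  let := sliceNormedSpace I
  (Complex.analyticAt_of_differentiable_on_punctured_nhds_of_continuousAt hg hc).differentiableAt

theorem eqOn_of_eq_on_reals {U : Set ℂ} (hU : IsOpen U) (hU' : IsPreconnected U)
    (hg : ∀ z ∈ U, HolomorphicAt I g z) (hh : ∀ z ∈ U, HolomorphicAt I h z) {x₀ : ℝ}
    (hx₀ : (x₀ : ℂ) ∈ U) (heq : ∀ᶠ x : ℝ in 𝓝[≠] x₀, g x = h x) : Set.EqOn g h U := by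
  let := sliceNormedSpace I
  have hA {k : ℂ → ℍ[ℝ]} (hk : ∀ z ∈ U, HolomorphicAt I k z) : AnalyticOnNhd ℂ k U :=
    DifferentiableOn.analyticOnNhd (fun z hz => (hk z hz).differentiableWithinAt) hU
  refine (hA hg).eqOn_of_preconnected_of_frequently_eq (hA hh) hU' hx₀ ?_
  have hofReal : Tendsto ((↑) : ℝ → ℂ) (𝓝[≠] x₀) (𝓝[≠] (x₀ : ℂ)) :=
    Complex.continuous_ofReal.continuousAt.continuousWithinAt.tendsto_nhdsWithin
      fun x hx => Complex.ofReal_injective.ne hx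
  exact hofReal.frequently heq.frequently

theorem eq_of_tendsto_cobounded (hg : ∀ z, HolomorphicAt I g z) {a : ℍ[ℝ]}
    (h : Tendsto g (cobounded ℂ) (𝓝 a)) (z : ℂ) : g z = a :=
  let := sliceNormedSpace I
  Differentiable.apply_eq_of_tendsto_cocompact hg z (Metric.cobounded_eq_cocompact (α := ℂ) ▸ h)

theorem IsRegularOn.holomorphicAt {Ω : Set ℍ[ℝ]} {f : ℍ[ℝ] → ℍ[ℝ]} (hf : IsRegularOn Ω f)
    (hz : sliceEmb I z ∈ Ω) : HolomorphicAt I (f ∘ sliceEmb I) z := by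
  have hcoe (x : ℝ) : HasDerivAt ((↑) : ℝ → ℍ[ℝ]) 1 x := by
    have hsmul := ((hasDerivAt_id x).smul_const (1 : ℍ[ℝ])).congr_deriv (one_smul ℝ 1)
    refine hsmul.congr_of_eventuallyEq (.of_forall fun r => ?_)
    simp [← Quaternion.coe_mul_eq_smul]
  set L := fderiv ℝ f (sliceEmb I z)
  have hL : HasFDerivAt f L (sliceEmb I z) :=
    (hf.differentiable.differentiableAt (hf.isOpen.mem_nhds hz)).hasFDerivAt
  have hre : deriv (fun s : ℝ => f (s + I * (z.im : ℍ[ℝ]))) z.re = L 1 :=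
    (HasFDerivAt.comp_hasDerivAt z.re (sliceEmb_apply I z ▸ hL) ((hcoe z.re).add_const _)).deriv
  have him : deriv (fun t : ℝ => f (z.re + I * (t : ℍ[ℝ]))) z.im = L I := by
    have hinner := ((hcoe z.im).const_mul (I : ℍ[ℝ])).const_add (z.re : ℍ[ℝ])
    rw [mul_one] at hinner
    exact (HasFDerivAt.comp_hasDerivAt z.im (sliceEmb_apply I z ▸ hL) hinner).deriv
  have hCR : L I = I * L 1 := by
    have hdbar := hf.dbar_eq_zero I I.2 z.re z.im (sliceEmb_apply I z ▸ hz)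
    rw [dbar, hre, him, smul_eq_zero_iff_right (by norm_num)] at hdbar
    rw [eq_neg_of_add_eq_zero_left hdbar, mul_neg, ← mul_assoc, imagUnit_mul_self, neg_one_mul,
      neg_neg]
  have hcomp : HasFDerivAt (f ∘ sliceEmb I)
      (L.comp (sliceEmb I).toLinearMap.toContinuousLinearMap) z :=
    hL.comp z (sliceEmb I).toLinearMap.toContinuousLinearMap.hasFDerivAt
  refine holomorphicAt_iff_cauchyRiemann.2 ⟨hcomp.differentiableAt, ?_⟩
  rw [hcomp.fderiv]
  simpa [sliceEmb_I] using hCR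

theorem representation_formula {F : ℍ[ℝ] → ℍ[ℝ]} {U : Set ℂ} (hU : IsOpen U)
    (hU' : IsPreconnected U) {x₀ : ℝ} (hx₀ : (x₀ : ℂ) ∈ U)
    (hF : ∀ K : imagUnits, ∀ z ∈ U, HolomorphicAt K (F ∘ sliceEmb K) z) (I J : imagUnits)
    (hz : z ∈ U) :
    2 * F (sliceEmb I z) =
      (1 - I * J : ℍ[ℝ]) * F (sliceEmb J z) + (1 + I * J : ℍ[ℝ]) * F (sliceEmb (-J) z) := by
  have hleft : (I * (1 - I * J) : ℍ[ℝ]) = (1 - I * J) * J := by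
    rw [mul_sub, sub_mul, ← mul_assoc, imagUnit_mul_self, mul_assoc, imagUnit_mul_self]
    simp [add_comm]
  have hright : (I * (1 + I * J) : ℍ[ℝ]) = (1 + I * J) * (-J : imagUnits) := by
    rw [coe_neg_imagUnit, mul_add, add_mul, ← mul_assoc, imagUnit_mul_self, mul_assoc, mul_neg J.1,
      imagUnit_mul_self]
    simp [add_comm]
  refine eqOn_of_eq_on_reals (I := I) hU hU'
    (fun w hw => (hF I w hw).const_mul (T := 2) (by simp [mul_two, two_mul]))
    (fun w hw => ((hF J w hw).const_mul hleft).add ((hF (-J) w hw).const_mul hright)) hx₀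
    (.of_forall fun x => ?_) hz
  simp only [Function.comp_apply, sliceEmb_ofReal]
  rw [← add_mul, sub_add_add_cancel, one_add_one_eq_two]

end HolomorphicAt

theorem exists_eq_mul_abs_sub_pow {ρ : ℝ → ℝ} (hρ : ∀ t, 0 ≤ ρ t) {C : ℂ} (hC : C ≠ 0) {x : ℝ}
    {m : ℕ} (h : ∀ t : ℝ, ((ρ t ^ 2 : ℝ) : ℂ) = C * (t - x) ^ m) :
    ∃ (c : ℝ) (n : ℕ), 0 < c ∧ ∀ t, ρ t = c * |t - x| ^ n := by
  have hnorm (t : ℝ) : ρ t ^ 2 = ‖C‖ * |t - x| ^ m := by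
    simpa [← Complex.ofReal_sub] using congrArg norm (h t)
  obtain ⟨n, rfl⟩ | hm := m.even_or_odd
  · refine ⟨√‖C‖, n, Real.sqrt_pos.2 (norm_pos_iff.2 hC), fun t => ?_⟩
    rw [← sq_eq_sq₀ (hρ t) (by positivity), hnorm, mul_pow, Real.sq_sqrt (norm_nonneg C), ← pow_mul,
      mul_two]
  · have hsum : ((ρ (x + 1) ^ 2 + ρ (x - 1) ^ 2 : ℝ) : ℂ) = 0 := by
      rw [Complex.ofReal_add, h, h]
      simp [hm.neg_one_pow]
    have hzero : ρ (x + 1) ^ 2 = 0 :=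
      ((add_eq_zero_iff_of_nonneg (sq_nonneg _) (sq_nonneg _)).1 (Complex.ofReal_eq_zero.1 hsum)).1
    rw [hnorm] at hzero
    exact absurd hzero (by simpa using hC)

theorem exists_norm_sub_eq_mul {E : Type*} [NormedAddCommGroup E] {d : ℝ → E}
    (hd : ∀ x, ∃ (c : ℝ) (n : ℕ), 0 < c ∧ ∀ t, ‖d t - d x‖ = c * |t - x| ^ n) :
    ∃ c : ℝ, 0 < c ∧ ∀ x t, ‖d t - d x‖ = c * |t - x| := by
  choose c n hc hdn using hd
  have hsymm (x t : ℝ) : c x * |t - x| ^ n x = c t * |t - x| ^ n t := by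
    rw [← hdn x t, norm_sub_rev, hdn t x, abs_sub_comm]
  have hc_add_two (x : ℝ) : c (x + 2) = c x := by
    have hc_add_one (x : ℝ) : c (x + 1) = c x := by simpa using (hsymm x (x + 1)).symm
    rw [← one_add_one_eq_two, ← add_assoc, hc_add_one, hc_add_one]
  have hn_add_two (x : ℝ) : n (x + 2) = n x := by
    have h := hsymm x (x + 2)
    rw [hc_add_two, add_sub_cancel_left, abs_two] at h
    exact (pow_right_injective₀ two_pos (by norm_num) (mul_left_cancel₀ (hc x).ne' h)).symm
  have hn_le (x : ℝ) : n x ≤ 1 := by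
    have htri := norm_sub_le_norm_sub_add_norm_sub (d (x + 2 + 2)) (d (x + 2)) (d x)
    rw [hdn x, hdn (x + 2), hdn x, hn_add_two, hc_add_two, add_sub_cancel_left, add_sub_cancel_left,
      add_assoc, add_sub_cancel_left, abs_two, ← two_mul, ← two_mul, abs_mul, abs_two, mul_pow,
      mul_left_comm] at htri
    have h2 := le_of_mul_le_mul_right htri (mul_pos (hc x) (pow_pos two_pos (n x)))
    exact (pow_le_pow_iff_right₀ (one_lt_two (α := ℝ))).1 (by simpa using h2)
  have hn (x : ℝ) : n x = 1 := by
    refine le_antisymm (hn_le x) (Nat.one_le_iff_ne_zero.2 fun h0 => (hc x).ne ?_)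
    simpa [h0] using hdn x x
  refine ⟨c 0, hc 0, fun x t => ?_⟩
  obtain rfl | hx := eq_or_ne x 0
  · rw [hdn 0 t, hn, pow_one]
  · have h0 := hsymm 0 x
    rw [hn, hn, sub_zero, pow_one] at h0
    rw [hdn x t, hn, pow_one, mul_right_cancel₀ (abs_ne_zero.2 hx) h0]

theorem exists_eq_smul_add_of_norm_sub_eq {E : Type*} [NormedAddCommGroup E] [NormedSpace ℝ E]
    [StrictConvexSpace ℝ E] {d : ℝ → E} {c : ℝ} (hc : 0 < c)
    (hd : ∀ x t, ‖d t - d x‖ = c * |t - x|) : ∃ a, ∀ t, d t = t • a + d 0 := by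
  have hiso : Isometry fun t => c⁻¹ • d t := Isometry.of_dist_eq fun t x => by
    rw [dist_eq_norm, ← smul_sub, norm_smul, hd, Real.norm_of_nonneg (inv_nonneg.2 hc.le),
      Real.dist_eq, inv_mul_cancel_left₀ hc.ne']
  set φ := hiso.affineIsometryOfStrictConvexSpace
  have hφ (t : ℝ) : c⁻¹ • d t = t • φ.linear 1 + c⁻¹ • d 0 := by
    have hadd : φ (t + 0) = φ.linear t + φ 0 := φ.toAffineMap.map_vadd 0 t
    have hsmul := φ.linear.map_smul t 1
    rwa [add_zero, ← mul_one t, ← smul_eq_mul, hsmul, smul_eq_mul, mul_one] at hadd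
  refine ⟨c • φ.linear 1, fun t => ?_⟩
  rw [← smul_inv_smul₀ hc.ne' (d t), hφ, smul_add, smul_inv_smul₀ hc.ne', smul_comm]

/-- The projection `x₀ + x₁ i + x₂ j + x₃ k ↦ x₀ + x₁ i` of `ℍ` onto `ℂ ≃ L_i`. -/
def complexPart : ℍ[ℝ] →L[ℝ] ℂ :=
  LinearMap.toContinuousLinearMap
    { toFun := fun q => ⟨q.re, q.imI⟩
      map_add' := fun _ _ => rfl
      map_smul' := fun r q => by apply Complex.ext <;> simp }

theorem complexPart_apply (q : ℍ[ℝ]) : complexPart q = ⟨q.re, q.imI⟩ := rfl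

theorem complexPart_unitI_mul (q : ℍ[ℝ]) : complexPart (unitI * q) = Complex.I * complexPart q := by
  apply Complex.ext <;> simp [complexPart_apply]

theorem complexPart_mul_unitI (q : ℍ[ℝ]) : complexPart (q * unitI) = Complex.I * complexPart q := by
  apply Complex.ext <;> simp [complexPart_apply]

theorem star_sliceEmb_complexPart (a b : ℍ[ℝ]) :
    star (sliceEmb unitI (complexPart ((a + unitI * b) * star (a - unitI * b)))) =
      a * star (a + unitI * b) - b * (star (a + unitI * b) * unitI) := by
  rw [star_sliceEmb, sliceEmb_apply]
  ext <;> simp [complexPart_apply] <;> ring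

/-- The restriction to `L_i ≃ ℂ` of the symmetrization `h^s = h * h^c` of a slice regular
function `h`: if `h(x + Iy) = α + Iβ`, it is `|α|² - |β|² + 2i Re(αβ̄)`. -/
def sliceSymm (h : ℍ[ℝ] → ℍ[ℝ]) (z : ℂ) : ℂ :=
  complexPart (h (sliceEmb unitI z) * star (h (sliceEmb (-unitI) z)))

theorem sliceSymm_ofReal (h : ℍ[ℝ] → ℍ[ℝ]) (t : ℝ) :
    sliceSymm h t = (‖h t‖ ^ 2 : ℝ) := by
  rw [sliceSymm, sliceEmb_ofReal, sliceEmb_ofReal, Quaternion.self_mul_star,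
    Quaternion.normSq_eq_norm_mul_self, sq]
  rfl

theorem differentiable_sliceSymm {h : ℍ[ℝ] → ℍ[ℝ]}
    (hh : ∀ (I : imagUnits) (z : ℂ), HolomorphicAt I (h ∘ sliceEmb I) z) :
    Differentiable ℂ (sliceSymm h) := by
  intro z
  obtain ⟨hu, hu'⟩ := holomorphicAt_iff_cauchyRiemann.1 (hh unitI z)
  obtain ⟨hv, hv'⟩ := holomorphicAt_iff_cauchyRiemann.1 (hh (-unitI) z)
  have : StarModule ℝ ℍ[ℝ] := ⟨fun r q => Quaternion.star_smul r q⟩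
  have hd := complexPart.hasFDerivAt.comp z (hu.hasFDerivAt.mul' hv.hasFDerivAt.star)
  refine differentiableAt_complex_iff_differentiableAt_real.2 ⟨hd.differentiableAt, ?_⟩
  set u := h ∘ sliceEmb unitI
  set v := h ∘ sliceEmb (-unitI)
  set u' := fderiv ℝ u z
  set v' := fderiv ℝ v z
  have hfd (w : ℂ) :
      fderiv ℝ (sliceSymm h) z w = complexPart (u z * star (v' w) + u' w * star (v z)) :=
    DFunLike.congr_fun (HasFDerivAt.fderiv (f := sliceSymm h) hd) w
  rw [smul_eq_mul, hfd, hfd, hu', hv', coe_neg_imagUnit, star_mul, star_neg, star_imagUnit, neg_neg,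
    ← mul_assoc, mul_assoc unitI.1, map_add, map_add, complexPart_mul_unitI, complexPart_unitI_mul,
    mul_add]

theorem exists_imagUnit_mul_eq (I : imagUnits) (a : ℍ[ℝ]) :
    ∃ J : imagUnits, (J : ℍ[ℝ]) * a = a * I := by
  obtain rfl | ha := eq_or_ne a 0
  · exact ⟨I, by rw [mul_zero, zero_mul]⟩
  · refine ⟨⟨a * I * a⁻¹, mem_imagUnits_iff.2 ?_⟩, inv_mul_cancel_right₀ ha _⟩
    rw [mul_assoc a, mul_assoc a, mul_assoc, inv_mul_cancel_left₀ ha, ← mul_assoc I.1,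
      imagUnit_mul_self, neg_one_mul, mul_neg, mul_inv_cancel₀ ha]

theorem exists_norm_sliceSymm_eq {h : ℍ[ℝ] → ℍ[ℝ]}
    (hh : ∀ (I : imagUnits) (z : ℂ), HolomorphicAt I (h ∘ sliceEmb I) z) (z : ℂ) :
    ∃ K : imagUnits, ‖sliceSymm h z‖ = ‖h (sliceEmb K z)‖ * ‖h (sliceEmb unitI z)‖ := by
  set u := h (sliceEmb unitI z)
  set v := h (sliceEmb (-unitI) z)
  set a : ℍ[ℝ] := (1 / 2 : ℝ) • (u + v)
  set b : ℍ[ℝ] := (1 / 2 : ℝ) • (unitI * (v - u))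
  have hab (K : imagUnits) : h (sliceEmb K z) = a + K * b := by
    have h2 := representation_formula isOpen_univ isPreconnected_univ (x₀ := 0) (Set.mem_univ _)
      (fun K z _ => hh K z) K unitI (Set.mem_univ z)
    calc h (sliceEmb K z) = (1 / 2 : ℝ) • (2 * h (sliceEmb K z)) := by
          rw [two_mul, ← two_smul ℝ, smul_smul, one_div_mul_cancel two_ne_zero, one_smul]
      _ = (1 / 2 : ℝ) • ((1 - K * unitI) * u + (1 + K * unitI) * v) := congrArg _ h2
      _ = a + K * b := by
          rw [mul_smul_comm, ← smul_add]
          noncomm_ring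
  have hu : u = a + unitI * b := hab unitI
  have hv : v = a - unitI * b := by
    rw [sub_eq_add_neg, ← neg_mul]
    exact hab (-unitI)
  obtain ⟨J, hJ⟩ := exists_imagUnit_mul_eq unitI (star u)
  obtain ⟨K, hK⟩ := exists_imagUnit_mul_eq J b
  refine ⟨-K, ?_⟩
  calc ‖sliceSymm h z‖ = ‖star (sliceEmb unitI (complexPart (u * star v)))‖ := by
        rw [norm_star, norm_sliceEmb]; rfl
    _ = ‖a * star u - b * (star u * unitI)‖ := by rw [hu, hv, star_sliceEmb_complexPart]
    _ = ‖(a + (-K : imagUnits) * b) * star u‖ := by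
        rw [← hJ, coe_neg_imagUnit, neg_mul, hK, ← sub_eq_add_neg, sub_mul, mul_assoc]
    _ = ‖h (sliceEmb (-K) z)‖ * ‖u‖ := by rw [norm_mul, norm_star, hab]

theorem tendsto_sliceSymm_cobounded {h : ℍ[ℝ] → ℍ[ℝ]}
    (hh : ∀ (I : imagUnits) (z : ℂ), HolomorphicAt I (h ∘ sliceEmb I) z)
    (hinf : Tendsto h (cobounded ℍ[ℝ]) (cobounded ℍ[ℝ])) :
    Tendsto (sliceSymm h) (cobounded ℂ) (cobounded ℂ) := by
  rw [← tendsto_norm_atTop_iff_cobounded] at hinf ⊢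
  rw [← comap_norm_atTop] at hinf ⊢
  refine tendsto_atTop.2 fun B => ?_
  have hlarge := hinf.eventually_ge_atTop (max B 1)
  rw [eventually_comap, eventually_atTop] at hlarge
  obtain ⟨R, hR⟩ := hlarge
  refine eventually_comap.2 ((eventually_ge_atTop R).mono fun r hr z hz => ?_)
  have hge (K : imagUnits) : max B 1 ≤ ‖h (sliceEmb K z)‖ := hR r hr _ (by rw [norm_sliceEmb, hz])
  obtain ⟨K, hK⟩ := exists_norm_sliceSymm_eq hh z
  calc B ≤ max B 1 * 1 := by rw [mul_one]; exact le_max_left _ _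
    _ ≤ ‖h (sliceEmb K z)‖ * ‖h (sliceEmb unitI z)‖ :=
      mul_le_mul (hge K) ((le_max_right _ _).trans (hge unitI)) zero_le_one (norm_nonneg _)
    _ = ‖sliceSymm h z‖ := hK.symm

section Injective

variable {g : ℍ[ℝ] → ℍ[ℝ]} (hinj : Function.Injective g)
  (hg : ∀ (I : imagUnits) (z : ℂ), HolomorphicAt I (g ∘ sliceEmb I) z)
  (hinf : Tendsto g (cobounded ℍ[ℝ]) (cobounded ℍ[ℝ]))

include hinj hg hinf

theorem exists_norm_sub_eq_mul_abs_pow (x : ℝ) :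
    ∃ (c : ℝ) (n : ℕ), 0 < c ∧ ∀ t : ℝ, ‖g t - g x‖ = c * |t - x| ^ n := by
  set h : ℍ[ℝ] → ℍ[ℝ] := fun q => g q - g x
  have hh (I : imagUnits) (z : ℂ) : HolomorphicAt I (h ∘ sliceEmb I) z :=
    (hg I z).sub (holomorphicAt_const _)
  have hzero (z : ℂ) (hz : sliceSymm h z = 0) : z = x := by
    have hx {K : imagUnits} (hK : ‖h (sliceEmb K z)‖ = 0) : z = x := by
      refine (isometry_sliceEmb K).injective ?_
      rw [sliceEmb_ofReal]
      exact hinj (sub_eq_zero.1 (norm_eq_zero.1 hK))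
    obtain ⟨K, hK⟩ := exists_norm_sliceSymm_eq hh z
    rw [hz, norm_zero, zero_eq_mul] at hK
    exact hK.elim hx hx
  obtain ⟨C, m, hC, hm⟩ := exists_eq_const_mul_pow_of_tendsto_cobounded
    (differentiable_sliceSymm hh)
    (tendsto_sliceSymm_cobounded hh ((tendsto_sub_const_cobounded (g x)).comp hinf)) hzero
  refine exists_eq_mul_abs_sub_pow (fun t => norm_nonneg _) hC (m := m) fun t => ?_
  rw [← hm, sliceSymm_ofReal]

theorem exists_eq_mul_add_of_injective : ∃ a b : ℍ[ℝ], a ≠ 0 ∧ ∀ q, g q = q * a + b := by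
  obtain ⟨c, hc, hd⟩ := exists_norm_sub_eq_mul (d := fun t : ℝ => g t)
    (exists_norm_sub_eq_mul_abs_pow hinj hg hinf)
  obtain ⟨a, ha⟩ := exists_eq_smul_add_of_norm_sub_eq hc hd
  have hall (q : ℍ[ℝ]) : g q = q * a + g (0 : ℝ) := by
    obtain ⟨I, z, rfl⟩ := exists_sliceEmb_eq q
    refine eqOn_of_eq_on_reals (I := I) (g := g ∘ sliceEmb I) isOpen_univ isPreconnected_univ
      (fun z _ => hg I z) (fun z _ => (holomorphicAt_sliceEmb_mul a).add (holomorphicAt_const _))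
      (x₀ := 0) (Set.mem_univ _) (.of_forall fun t => ?_) (Set.mem_univ z)
    rw [Function.comp_apply, sliceEmb_ofReal, ha, Quaternion.coe_mul_eq_smul]
  refine ⟨a, g (0 : ℝ), fun ha0 => zero_ne_one (α := ℍ[ℝ]) (hinj ?_), hall⟩
  rw [hall 0, hall 1, ha0, mul_zero, mul_zero]

end Injective

theorem tendsto_coe_nhds_infty_iff {X Y : Type*} [PseudoMetricSpace Y] [ProperSpace Y] [T2Space Y]
    {l : Filter X} {f : X → Y} :
    Tendsto (fun x => (f x : OnePoint Y)) l (𝓝 OnePoint.infty) ↔ Tendsto f l (cobounded Y) := by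
  rw [Metric.cobounded_eq_cocompact, ← coclosedCompact_eq_cocompact,
    ← OnePoint.comap_coe_nhds_infty, tendsto_comap_iff, Function.comp_def]

section HomogeneousCoordinates

variable {K : Type*} [DivisionRing K]

open Classical in
/-- The point of the projective line `K ∪ {∞}` with left homogeneous coordinates `[v 0 : v 1]`,
that is `(v 1)⁻¹ * v 0`. The zero vector is sent to `∞` by convention. -/
def homogRatio (v : Fin 2 → K) : OnePoint K :=
  if v 1 = 0 then OnePoint.infty else ((v 1)⁻¹ * v 0 : K)

theorem homogRatio_of_eq_zero {v : Fin 2 → K} (hv : v 1 = 0) : homogRatio v = OnePoint.infty :=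
  if_pos hv

theorem homogRatio_of_ne_zero {v : Fin 2 → K} (hv : v 1 ≠ 0) :
    homogRatio v = ((v 1)⁻¹ * v 0 : K) :=
  if_neg hv

theorem homogRatio_eq_infty_iff {v : Fin 2 → K} : homogRatio v = OnePoint.infty ↔ v 1 = 0 := by
  simp [homogRatio]

theorem homogRatio_smul {u : K} (hu : u ≠ 0) (v : Fin 2 → K) :
    homogRatio (u • v) = homogRatio v := by
  by_cases hv : v 1 = 0
  · rw [homogRatio_of_eq_zero hv, homogRatio_of_eq_zero (by simp [hv])]
  · rw [homogRatio_of_ne_zero hv, homogRatio_of_ne_zero (by simp [hu, hv])]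
    simp [hu, mul_assoc]

/-- Normalized homogeneous coordinates of a point of `K ∪ {∞}`. -/
def homogCoord : OnePoint K → Fin 2 → K
  | none => ![1, 0]
  | some q => ![q, 1]

theorem homogCoord_ne_zero (p : OnePoint K) : homogCoord p ≠ 0 := by
  cases p
  · exact fun h => one_ne_zero (congrFun h 0)
  · exact fun h => one_ne_zero (congrFun h 1)

theorem homogRatio_homogCoord (p : OnePoint K) : homogRatio (homogCoord p) = p := by
  cases p
  · exact homogRatio_of_eq_zero rfl
  · simp [homogRatio, homogCoord]

theorem exists_homogCoord_homogRatio_eq_smul {v : Fin 2 → K} (hv : v ≠ 0) :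
    ∃ u : K, u ≠ 0 ∧ homogCoord (homogRatio v) = u • v := by
  by_cases h1 : v 1 = 0
  · have h0 : v 0 ≠ 0 := fun h0 => hv (by ext i; fin_cases i <;> assumption)
    refine ⟨(v 0)⁻¹, inv_ne_zero h0, ?_⟩
    rw [homogRatio_of_eq_zero h1]
    ext i; fin_cases i <;> simp [homogCoord, h0, h1]
  · refine ⟨(v 1)⁻¹, inv_ne_zero h1, ?_⟩
    rw [homogRatio_of_ne_zero h1]
    ext i; fin_cases i <;> simp [homogCoord, h1]

theorem continuousAt_homogRatio {K : Type*} [NormedDivisionRing K] [ProperSpace K] {v : Fin 2 → K}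
    (hv : v ≠ 0) : ContinuousAt homogRatio v := by
  classical
  by_cases h1 : v 1 = 0
  · have h0 : v 0 ≠ 0 := fun h0 => hv (by ext i; fin_cases i <;> assumption)
    rw [ContinuousAt, homogRatio_of_eq_zero h1]
    refine Tendsto.if tendsto_const_nhds (tendsto_coe_nhds_infty_iff.2 ?_)
    have hden : Tendsto (fun w : Fin 2 → K => w 1) (𝓝 v ⊓ 𝓟 {w | w 1 ≠ 0}) (𝓝[≠] 0) :=
      tendsto_nhdsWithin_iff.2
        ⟨h1 ▸ (continuous_apply 1).continuousAt.mono_left inf_le_left,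
          eventually_inf_principal.2 (.of_forall fun _ => id)⟩
    have hnum : Tendsto (fun w : Fin 2 → K => w 0) (𝓝 v ⊓ 𝓟 {w | w 1 ≠ 0}) (𝓝 (v 0)) :=
      (continuous_apply 0).continuousAt.mono_left inf_le_left
    rw [← tendsto_norm_atTop_iff_cobounded]
    simp only [norm_mul]
    exact (tendsto_norm_cobounded_atTop.comp (tendsto_inv₀_nhdsNE_zero.comp hden)).atTop_mul_pos
      (norm_pos_iff.2 h0) hnum.norm
  · have hratio : ContinuousAt (fun w : Fin 2 → K => (w 1)⁻¹ * w 0) v :=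
      ((continuous_apply 1).continuousAt.inv₀ h1).mul (continuous_apply 0).continuousAt
    refine (OnePoint.continuous_coe.continuousAt.comp hratio).congr ?_
    filter_upwards [(continuous_apply 1).continuousAt.eventually_ne h1] with w hw
    exact (homogRatio_of_ne_zero hw).symm

end HomogeneousCoordinates

theorem homogCoord_coe_vecMul (A : Matrix (Fin 2) (Fin 2) ℍ[ℝ]) (q : ℍ[ℝ]) :
    homogCoord q ᵥ* A = ![q * A 0 0 + A 1 0, q * A 0 1 + A 1 1] := by
  ext1 j
  fin_cases j <;> simp [homogCoord, vecMul_eq_sum]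

theorem homogCoord_infty_vecMul (A : Matrix (Fin 2) (Fin 2) ℍ[ℝ]) :
    homogCoord OnePoint.infty ᵥ* A = ![A 0 0, A 0 1] := by
  ext1 j
  fin_cases j <;> simp [homogCoord, vecMul_eq_sum]

theorem linFrac_eq_homogRatio (A : GL2H) (p : OnePoint ℍ[ℝ]) :
    linFrac A p = homogRatio (homogCoord p ᵥ* A.val) := by
  cases p
  · rw [homogCoord_infty_vecMul]; rfl
  · rw [homogCoord_coe_vecMul]; rfl

theorem linFrac_infty_eq_infty_iff {A : GL2H} :
    linFrac A OnePoint.infty = OnePoint.infty ↔ A.val 0 1 = 0 := by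
  rw [linFrac_eq_homogRatio, homogCoord_infty_vecMul]
  exact homogRatio_eq_infty_iff

theorem linFrac_coe_eq_infty_iff {A : GL2H} {q : ℍ[ℝ]} :
    linFrac A q = OnePoint.infty ↔ q * A.val 0 1 + A.val 1 1 = 0 := by
  rw [linFrac_eq_homogRatio, homogCoord_coe_vecMul]
  exact homogRatio_eq_infty_iff

theorem linFrac_coe {A : GL2H} {q : ℍ[ℝ]} (hq : q * A.val 0 1 + A.val 1 1 ≠ 0) :
    linFrac A q = ((q * A.val 0 1 + A.val 1 1)⁻¹ * (q * A.val 0 0 + A.val 1 0) : ℍ[ℝ]) := by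
  rw [linFrac_eq_homogRatio, homogCoord_coe_vecMul]
  exact homogRatio_of_ne_zero hq

theorem vecMul_ne_zero (A : GL2H) {v : Fin 2 → ℍ[ℝ]} (hv : v ≠ 0) : v ᵥ* A.val ≠ 0 := fun h =>
  hv <| by rw [← vecMul_one v, ← A.mul_inv, ← vecMul_vecMul, h, zero_vecMul]

theorem linFrac_mul (A B : GL2H) (p : OnePoint ℍ[ℝ]) :
    linFrac (A * B) p = linFrac B (linFrac A p) := by
  obtain ⟨u, hu, h⟩ :=
    exists_homogCoord_homogRatio_eq_smul (vecMul_ne_zero A (homogCoord_ne_zero p))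
  simp only [linFrac_eq_homogRatio, h, smul_vecMul, homogRatio_smul hu, vecMul_vecMul,
    Units.val_mul]

theorem linFrac_one (p : OnePoint ℍ[ℝ]) : linFrac 1 p = p := by
  rw [linFrac_eq_homogRatio, Units.val_one, vecMul_one, homogRatio_homogCoord]

theorem continuous_linFrac (A : GL2H) : Continuous (linFrac A) := by
  have hA {v : ℍ[ℝ] → Fin 2 → ℍ[ℝ]} (hv : Continuous v) {q : ℍ[ℝ]} (hq : v q ≠ 0) :
      ContinuousAt (fun q => homogRatio (v q ᵥ* A.val)) q :=
    (continuousAt_homogRatio (vecMul_ne_zero A hq)).comp (f := fun q => v q ᵥ* A.val)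
      (hv.matrix_vecMul continuous_const).continuousAt
  rw [continuous_iff_continuousAt]
  intro p
  cases p with
  | infty =>
    rw [OnePoint.continuousAt_infty', coclosedCompact_eq_cocompact, ← Metric.cobounded_eq_cocompact]
    have hinv := (hA (v := fun q => ![1, q]) (by fun_prop) (q := 0)
      (homogCoord_ne_zero OnePoint.infty)).tendsto.comp tendsto_inv₀_cobounded
    rw [linFrac_eq_homogRatio]
    refine hinv.congr' ?_
    filter_upwards [eventually_ne_cobounded (0 : ℍ[ℝ])] with q hq
    have hsmul : ![q, 1] = q • ![1, q⁻¹] := by simp [hq]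
    change homogRatio (![1, q⁻¹] ᵥ* A.val) = linFrac A q
    rw [linFrac_eq_homogRatio, ← homogRatio_smul hq, ← smul_vecMul, ← hsmul]
    rfl
  | coe q =>
    rw [OnePoint.continuousAt_coe]
    have hcont := hA (v := fun q => ![q, 1]) (by fun_prop) (homogCoord_ne_zero (q : OnePoint ℍ[ℝ]))
    exact hcont.congr <| .of_forall fun q => (linFrac_eq_homogRatio A q).symm

/-- The linear fractional transformation of `A`, as a homeomorphism of `ℍ ∪ {∞}`. -/
def linFracHomeomorph (A : GL2H) : OnePoint ℍ[ℝ] ≃ₜ OnePoint ℍ[ℝ] where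
  toFun := linFrac A
  invFun := linFrac A⁻¹
  left_inv p := by rw [← linFrac_mul, mul_inv_cancel, linFrac_one]
  right_inv p := by rw [← linFrac_mul, inv_mul_cancel, linFrac_one]
  continuous_toFun := continuous_linFrac A
  continuous_invFun := continuous_linFrac A⁻¹

theorem hasSum_pow_smul_of_hasSum_zpow_smul {𝕜 E : Type*} [DivisionRing 𝕜] [AddCommGroup E]
    [Module 𝕜 E] [TopologicalSpace E] [ContinuousConstSMul 𝕜 E] {w : 𝕜} (hw : w ≠ 0) {a : ℤ → E}
    {s : E} {m : ℕ} (ha : ∀ k : ℕ, m < k → a (-(k : ℤ)) = 0)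
    (h : HasSum (fun n : ℤ => w ^ n • a n) s) :
    HasSum (fun k : ℕ => w ^ k • a (k - m)) (w ^ m • s) := by
  have hshift : HasSum (fun k : ℤ => w ^ k • a (k - m)) (w ^ m • s) := by
    rw [← (Equiv.addRight (m : ℤ)).hasSum_iff]
    refine (h.const_smul (w ^ m)).congr_fun fun n => ?_
    simp only [Function.comp_apply, Equiv.coe_addRight, add_sub_cancel_right]
    rw [smul_smul, ← zpow_natCast, ← zpow_add₀ hw, add_comm]
  rw [← (Nat.cast_injective (R := ℤ)).hasSum_iff] at hshift
  · simpa only [Function.comp_def, zpow_natCast] using hshift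
  · intro k hk
    have hk0 : k < 0 := by
      by_contra! h0
      exact hk ⟨k.toNat, Int.toNat_of_nonneg h0⟩
    have hzero := ha (m + (-k).toNat) (by lia)
    rw [show -((m + (-k).toNat : ℕ) : ℤ) = k - m by lia] at hzero
    rw [hzero, smul_zero]

theorem tendsto_cobounded_of_tendsto_pow_smul {𝕜 E : Type*} [NormedField 𝕜] [NormedAddCommGroup E]
    [NormedSpace 𝕜 E] {F : 𝕜 → E} {z₀ : 𝕜} {c : E} {m : ℕ} (hm : m ≠ 0) (hc : c ≠ 0)
    (h : Tendsto (fun z => (z - z₀) ^ m • F z) (𝓝[≠] z₀) (𝓝 c)) :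
    Tendsto F (𝓝[≠] z₀) (cobounded E) := by
  rw [← tendsto_norm_atTop_iff_cobounded]
  have hpow : Tendsto (fun z => (z - z₀) ^ m) (𝓝[≠] z₀) (𝓝[≠] 0) := by
    refine tendsto_nhdsWithin_iff.2 ⟨?_, ?_⟩
    · have : ContinuousAt (fun z => (z - z₀) ^ m) z₀ := by fun_prop
      simpa [hm] using this.tendsto.mono_left nhdsWithin_le_nhds
    · filter_upwards [self_mem_nhdsWithin] with z hz
      exact pow_ne_zero m (sub_ne_zero.2 hz)
  have hinv := tendsto_norm_cobounded_atTop.comp (tendsto_inv₀_nhdsNE_zero.comp hpow)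
  refine (hinv.atTop_mul_pos (norm_pos_iff.2 hc) h.norm).congr' ?_
  filter_upwards [self_mem_nhdsWithin] with z hz
  have hz' : (z - z₀) ^ m ≠ 0 := pow_ne_zero m (sub_ne_zero.2 hz)
  rw [Function.comp_apply, Function.comp_apply, ← norm_smul, inv_smul_smul₀ hz']

theorem HasLaurentExpansion.eventually_hasSum {Ω : Set ℍ[ℝ]} {f : ℍ[ℝ] → ℍ[ℝ]} {I : imagUnits}
    {z₀ : ℂ} {R : ℝ} {a : ℤ → ℍ[ℝ]} (h : HasLaurentExpansion Ω f I (sliceEmb I z₀) R a) :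
    letI := sliceNormedSpace I
    ∀ᶠ z in 𝓝[≠] z₀,
      sliceEmb I z ∈ Ω ∧ HasSum (fun n : ℤ => (z - z₀) ^ n • a n) (f (sliceEmb I z)) := by
  filter_upwards [self_mem_nhdsWithin, mem_nhdsWithin_of_mem_nhds (Metric.ball_mem_nhds z₀ h.1)]
    with z hz hzR
  obtain ⟨hΩ, hsum⟩ := h.2 (sliceEmb I z) (mem_slice_iff.2 ⟨z, rfl⟩)
    ((isometry_sliceEmb I).injective.ne hz)
    (by rwa [← map_sub, norm_sliceEmb, ← dist_eq_norm])
  refine ⟨hΩ, hsum.congr_fun fun n => ?_⟩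
  change sliceEmb I ((z - z₀) ^ n) * a n = _
  rw [map_zpow₀, map_sub]

theorem IsSemiregular.preimage_mem_codiscrete {Ω : Set ℍ[ℝ]} {f : ℍ[ℝ] → ℍ[ℝ]}
    (hf : IsSemiregular Ω f) (I : imagUnits) : sliceEmb I ⁻¹' Ω ∈ codiscrete ℂ := by
  rw [codiscrete, mem_codiscreteWithin_iff_forall_mem_nhdsNE]
  intro z₀ _
  rw [Set.compl_univ, Set.union_empty]
  by_cases hz₀ : sliceEmb I z₀ ∈ Ω
  · exact mem_nhdsWithin_of_mem_nhds <|
      (isometry_sliceEmb I).continuous.continuousAt (hf.isRegularOn.isOpen.mem_nhds hz₀)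
  · obtain ⟨R, a, N, ha, -⟩ := hf.nonessential _ hz₀ I I.2 (mem_slice_iff.2 ⟨z₀, rfl⟩)
    exact ha.eventually_hasSum.mono fun z hz => hz.1

theorem HasPoleAt.eventually_mem {Ω : Set ℍ[ℝ]} {f : ℍ[ℝ] → ℍ[ℝ]} {I : imagUnits} {z₀ : ℂ}
    (h : HasPoleAt Ω f (sliceEmb I z₀)) : ∀ᶠ z in 𝓝[≠] z₀, sliceEmb I z ∈ Ω := by
  obtain ⟨R, a, N, ha, -⟩ := h I I.2 (mem_slice_iff.2 ⟨z₀, rfl⟩)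
  exact ha.eventually_hasSum.mono fun z hz => hz.1

theorem HasPoleAt.tendsto_cobounded {Ω : Set ℍ[ℝ]} {f : ℍ[ℝ] → ℍ[ℝ]} {I : imagUnits} {z₀ : ℂ}
    (h : HasPoleAt Ω f (sliceEmb I z₀)) :
    Tendsto (f ∘ sliceEmb I) (𝓝[≠] z₀) (cobounded ℍ[ℝ]) := by
  classical
  let := sliceNormedSpace I
  obtain ⟨R, a, N, ha, hN, m₀, hm₀, ham₀⟩ := h I I.2 (mem_slice_iff.2 ⟨z₀, rfl⟩)
  have hm₀N : m₀ ≤ N := not_lt.1 fun hlt => ham₀ (hN m₀ hlt)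
  let P (k : ℕ) : Prop := a (-(k : ℤ)) ≠ 0
  let m := Nat.findGreatest P N
  have ham : a (-(m : ℤ)) ≠ 0 := Nat.findGreatest_spec (P := P) hm₀N ham₀
  have hm : m ≠ 0 := (hm₀.trans_le (Nat.le_findGreatest (P := P) hm₀N ham₀)).ne'
  have hgt (k : ℕ) (hk : m < k) : a (-(k : ℤ)) = 0 := by
    by_cases hkN : k ≤ N
    · exact not_not.1 (Nat.findGreatest_is_greatest (P := P) hk hkN)
    · exact hN k (not_le.1 hkN)
  refine tendsto_cobounded_of_tendsto_pow_smul hm ham ?_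
  have hpow : ∀ᶠ z in 𝓝[≠] z₀, HasSum (fun k : ℕ => (z - z₀) ^ k • a (k - m))
      ((z - z₀) ^ m • (f ∘ sliceEmb I) z) := by
    filter_upwards [ha.eventually_hasSum, self_mem_nhdsWithin] with z hz hne
    exact hasSum_pow_smul_of_hasSum_zpow_smul (sub_ne_zero.2 hne) hgt hz.2
  simpa using tendsto_of_hasSum_pow_smul hpow

section RegularQuotient

variable {q : ℍ[ℝ]}

theorem star_coeff_symmetrization (f : PowerSeries ℍ[ℝ]) (n : ℕ) :
    star (PowerSeries.coeff n (symmetrization f)) = PowerSeries.coeff n (symmetrization f) := by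
  simp only [symmetrization, regConj, PowerSeries.coeff_mul, PowerSeries.coeff_mk, star_sum,
    star_mul, star_star]
  exact Finset.Nat.sum_antidiagonal_swap (n := n)
    (f := fun p => PowerSeries.coeff p.1 f * star (PowerSeries.coeff p.2 f))

theorem regConj_C_mul (u : ℍ[ℝ]) (f : PowerSeries ℍ[ℝ]) :
    regConj (PowerSeries.C u * f) = regConj f * PowerSeries.C (star u) := by
  ext1 n
  simp [regConj]

theorem symmetrization_C_mul (u : ℍ[ℝ]) (f : PowerSeries ℍ[ℝ]) :
    symmetrization (PowerSeries.C u * f) = Quaternion.normSq u • symmetrization f := by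
  ext1 n
  have hself := star_coeff_symmetrization f n
  rw [symmetrization] at hself
  rw [symmetrization, regConj_C_mul, ← mul_assoc, mul_assoc (PowerSeries.C u),
    PowerSeries.coeff_mul_C, PowerSeries.coeff_C_mul, symmetrization, PowerSeries.coeff_smul]
  rw [Quaternion.star_eq_self] at hself
  rw [hself, ← Quaternion.coe_commutes, mul_assoc, Quaternion.self_mul_star,
    Quaternion.coe_mul_eq_smul, Quaternion.smul_coe, Quaternion.smul_coe, mul_comm]

theorem evalSeries_smul (r : ℝ) (f : PowerSeries ℍ[ℝ]) (q : ℍ[ℝ]) :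
    evalSeries (r • f) q = r • evalSeries f q := by
  simp only [evalSeries, PowerSeries.coeff_smul, mul_smul_comm]
  exact tsum_const_smul'' r

theorem regQuotDomain_C_mul {u : ℍ[ℝ]} (hu : u ≠ 0) (f : PowerSeries ℍ[ℝ]) :
    regQuotDomain (PowerSeries.C u * f) = regQuotDomain f := by
  ext q
  simp only [regQuotDomain, symmetrization_C_mul, evalSeries_smul]
  simp [hu]

theorem regQuot_C_mul {u : ℍ[ℝ]} (hu : u ≠ 0) (f g : PowerSeries ℍ[ℝ]) :
    regQuot (PowerSeries.C u * f) (PowerSeries.C u * g) = regQuot f g := by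
  have hnum : regConj (PowerSeries.C u * f) * (PowerSeries.C u * g) =
      Quaternion.normSq u • (regConj f * g) := by
    have hC : PowerSeries.C (star u) * PowerSeries.C u =
        algebraMap ℝ (PowerSeries ℍ[ℝ]) (Quaternion.normSq u) := by
      rw [← map_mul, Quaternion.star_mul_self, PowerSeries.algebraMap_apply,
        Quaternion.algebraMap_def]
    rw [regConj_C_mul, mul_assoc, ← mul_assoc (PowerSeries.C (star u)), hC, ← mul_assoc,
      ← Algebra.commutes, mul_assoc, Algebra.smul_def]
  ext1 q
  rw [regQuot, symmetrization_C_mul, hnum, evalSeries_smul, evalSeries_smul, smul_inv₀,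
    smul_mul_smul_comm, inv_mul_cancel₀ (Quaternion.normSq_ne_zero.2 hu), one_smul, regQuot]

theorem C_mul_affineSeries (u a b : ℍ[ℝ]) :
    PowerSeries.C u * affineSeries a b = affineSeries (u * a) (u * b) := by
  rw [affineSeries, mul_add, ← mul_assoc, (PowerSeries.commute_X (PowerSeries.C u)).eq, mul_assoc,
    ← map_mul, ← map_mul, affineSeries]

theorem coeff_affineSeries (a b : ℍ[ℝ]) (n : ℕ) :
    PowerSeries.coeff n (affineSeries a b) = if n = 0 then b else if n = 1 then a else 0 := by
  rw [affineSeries, map_add]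
  match n with
  | 0 => simp
  | 1 => simp
  | n + 2 => simp [PowerSeries.coeff_X]

theorem regConj_affineSeries (c d : ℍ[ℝ]) :
    regConj (affineSeries c d) = affineSeries (star c) (star d) := by
  ext1 n
  simp only [regConj, PowerSeries.coeff_mk, coeff_affineSeries]
  split_ifs <;> simp

theorem coeff_zero_affineSeries_mul (c d : ℍ[ℝ]) (g : PowerSeries ℍ[ℝ]) :
    PowerSeries.coeff 0 (affineSeries c d * g) = d * PowerSeries.coeff 0 g := by
  rw [affineSeries, add_mul, mul_assoc, map_add, PowerSeries.coeff_zero_X_mul,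
    PowerSeries.coeff_C_mul, zero_add]

theorem coeff_succ_affineSeries_mul (c d : ℍ[ℝ]) (g : PowerSeries ℍ[ℝ]) (n : ℕ) :
    PowerSeries.coeff (n + 1) (affineSeries c d * g) =
      c * PowerSeries.coeff n g + d * PowerSeries.coeff (n + 1) g := by
  rw [affineSeries, add_mul, mul_assoc, map_add, PowerSeries.coeff_succ_X_mul,
    PowerSeries.coeff_C_mul, PowerSeries.coeff_C_mul]

theorem evalSeries_affineSeries_mul {c d : ℍ[ℝ]} (hc : Commute q c) (hd : Commute q d)
    (a b : ℍ[ℝ]) :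
    evalSeries (affineSeries c d * affineSeries a b) q = (q * c + d) * (q * a + b) := by
  have hsum : evalSeries (affineSeries c d * affineSeries a b) q =
      d * b + q * (c * b + d * a) + q ^ 2 * (c * a) := by
    rw [evalSeries, tsum_eq_sum (s := Finset.range 3)]
    · simp [Finset.sum_range_succ, coeff_zero_affineSeries_mul, coeff_succ_affineSeries_mul,
        coeff_affineSeries]
    · intro n hn
      obtain ⟨m, rfl⟩ : ∃ m, n = m + 2 + 1 := ⟨n - 3, by simp at hn; lia⟩
      simp [coeff_succ_affineSeries_mul, coeff_affineSeries]
  have hca : q ^ 2 * (c * a) = q * c * (q * a) := by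
    rw [sq, mul_assoc, ← mul_assoc q c a, hc.eq, mul_assoc c, ← mul_assoc q c, hc.eq,
      mul_assoc c]
  have hda : q * (d * a) = d * (q * a) := by rw [← mul_assoc, hd.eq, mul_assoc]
  rw [hsum, mul_add, hda, hca, ← mul_assoc]
  noncomm_ring

theorem commute_star_right {p : ℍ[ℝ]} (h : Commute q p) : Commute q (star p) := by
  rw [Quaternion.star_eq_two_re_sub]
  exact (Quaternion.coe_commute _ q).symm.sub_right h

theorem commute_of_isSelfAdjoint {p : ℍ[ℝ]} (hp : IsSelfAdjoint p) : Commute q p := by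
  rw [Quaternion.star_eq_self.1 hp]
  exact (Quaternion.coe_commute _ q).symm

theorem commute_mul_add_mul_star_add_star {c d : ℍ[ℝ]} (hc : Commute q c) (hd : Commute q d) :
    Commute (q * c + d) (q * star c + star d) := by
  have hq : Commute (q * c + d) q := (((Commute.refl q).mul_right hc).add_right hd).symm
  have hreal (r : ℝ) : Commute (q * c + d) r := (Quaternion.coe_commute r _).symm
  have heq : q * star c + star d =
      q * (2 * c.re : ℝ) + (2 * d.re : ℝ) - (q * c + d) := by
    rw [Quaternion.star_eq_two_re_sub, Quaternion.star_eq_two_re_sub, mul_sub]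
    abel
  rw [heq]
  exact ((hq.mul_right (hreal _)).add_right (hreal _)).sub_right (Commute.refl _)

theorem evalSeries_symmetrization_affineSeries {c d : ℍ[ℝ]} (hc : Commute q c) (hd : Commute q d) :
    evalSeries (symmetrization (affineSeries c d)) q = (q * c + d) * (q * star c + star d) := by
  rw [symmetrization, regConj_affineSeries, evalSeries_affineSeries_mul hc hd]

theorem mem_regFracDomain_iff_of_isSelfAdjoint {A : GL2H} (hc : IsSelfAdjoint (A.val 0 1))
    (hd : IsSelfAdjoint (A.val 1 1)) :
    q ∈ regFracDomain A ↔ q * A.val 0 1 + A.val 1 1 ≠ 0 := by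
  rw [regFracDomain, regQuotDomain, Set.mem_ofPred_eq, evalSeries_symmetrization_affineSeries
    (commute_of_isSelfAdjoint hc) (commute_of_isSelfAdjoint hd), hc.star_eq, hd.star_eq,
    mul_self_ne_zero]

theorem coe_regFrac_of_commute {A : GL2H} (hc : Commute q (A.val 0 1))
    (hd : Commute q (A.val 1 1)) (hq : q ∈ regFracDomain A) :
    (regFrac A q : OnePoint ℍ[ℝ]) = linFrac A q := by
  rw [regFracDomain, regQuotDomain, Set.mem_ofPred_eq,
    evalSeries_symmetrization_affineSeries hc hd] at hq
  rw [linFrac_coe (left_ne_zero_of_mul hq), regFrac, regQuot,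
    evalSeries_symmetrization_affineSeries hc hd, regConj_affineSeries,
    evalSeries_affineSeries_mul (commute_star_right hc) (commute_star_right hd),
    (commute_mul_add_mul_star_add_star hc hd).eq, _root_.mul_inv_rev, mul_assoc,
    inv_mul_cancel_left₀ (right_ne_zero_of_mul hq)]

end RegularQuotient

/-- The left multiple `uA` of a matrix by an invertible quaternion. -/
def leftScale (u : ℍ[ℝ]ˣ) (A : GL2H) : GL2H :=
  Units.map (scalar (Fin 2)).toMonoidHom u * A

theorem leftScale_apply (u : ℍ[ℝ]ˣ) (A : GL2H) (i j : Fin 2) :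
    (leftScale u A).val i j = u * A.val i j := by
  simp [leftScale, scalar_apply, diagonal_mul]

theorem regFracDomain_leftScale (u : ℍ[ℝ]ˣ) (A : GL2H) :
    regFracDomain (leftScale u A) = regFracDomain A := by
  simp only [regFracDomain, leftScale_apply, ← C_mul_affineSeries, regQuotDomain_C_mul u.ne_zero]

theorem regFrac_leftScale (u : ℍ[ℝ]ˣ) (A : GL2H) : regFrac (leftScale u A) = regFrac A := by
  simp only [regFrac, leftScale_apply, ← C_mul_affineSeries, regQuot_C_mul u.ne_zero]

section RealPole

variable {A : GL2H} {Ω : Set ℍ[ℝ]} {f : ℍ[ℝ] → ℍ[ℝ]}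

theorem HasPoleAt.eq_infty_of_tendsto {x : ℝ} (h : HasPoleAt Ω f x) {φ : ℍ[ℝ] → OnePoint ℍ[ℝ]}
    {p : OnePoint ℍ[ℝ]} (hφ : Tendsto φ (𝓝[≠] x) (𝓝 p))
    (hfφ : ∀ t : ℝ, (t : ℍ[ℝ]) ∈ Ω → (f t : OnePoint ℍ[ℝ]) = φ t) : p = OnePoint.infty := by
  rw [← sliceEmb_ofReal unitI x] at h
  have hreal : Tendsto Complex.ofReal (𝓝[≠] x) (𝓝[≠] x) :=
    Complex.continuous_ofReal.continuousWithinAt.tendsto_nhdsWithin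
      fun t ht => Complex.ofReal_injective.ne ht
  have hquat : Tendsto (fun t : ℝ => (t : ℍ[ℝ])) (𝓝[≠] x) (𝓝[≠] x) :=
    Quaternion.continuous_coe.continuousWithinAt.tendsto_nhdsWithin
      fun t ht => Quaternion.coe_injective.ne ht
  have hf := tendsto_coe_nhds_infty_iff.2 (h.tendsto_cobounded.comp hreal)
  refine tendsto_nhds_unique_of_eventuallyEq (hφ.comp hquat) hf ?_
  filter_upwards [hreal.eventually h.eventually_mem] with t ht
  rw [sliceEmb_ofReal] at ht
  simp only [Function.comp_apply, sliceEmb_ofReal, hfφ t ht]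

theorem linFrac_injective (A : GL2H) : Function.Injective (linFrac A) :=
  (linFracHomeomorph A).injective

theorem linFrac_coe_eq_infty_of_hasPoleAt {x : ℝ}
    (h : HasPoleAt (regFracDomain A) (regFrac A) x) :
    linFrac A (x : ℍ[ℝ]) = OnePoint.infty :=
  h.eq_infty_of_tendsto
    (((continuous_linFrac A).comp OnePoint.continuous_coe).continuousAt.mono_left
      nhdsWithin_le_nhds)
    fun t => coe_regFrac_of_commute (Quaternion.coe_commute t _) (Quaternion.coe_commute t _)

theorem linFrac_infty_eq_infty_of_hasPoleAtInfty
    (h : HasPoleAtInfty (regFracDomain A) (regFrac A)) :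
    linFrac A OnePoint.infty = OnePoint.infty := by
  rw [HasPoleAtInfty, ← Quaternion.coe_zero] at h
  have hinv : Tendsto (fun q : ℍ[ℝ] => ((q⁻¹ : ℍ[ℝ]) : OnePoint ℍ[ℝ])) (𝓝[≠] 0)
      (𝓝 OnePoint.infty) :=
    tendsto_coe_nhds_infty_iff.2 tendsto_inv₀_nhdsNE_zero
  refine h.eq_infty_of_tendsto (((continuous_linFrac A).tendsto _).comp hinv) fun t ht => ?_
  have hmem := ht.2
  rw [← Quaternion.coe_inv] at hmem
  rw [Function.comp_apply, ← Quaternion.coe_inv]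
  exact coe_regFrac_of_commute (Quaternion.coe_commute _ _) (Quaternion.coe_commute _ _) hmem

theorem exists_leftScale_of_linFrac_coe_eq_infty {x : ℝ}
    (hx : linFrac A (x : ℍ[ℝ]) = OnePoint.infty) :
    ∃ u, (leftScale u A).val 0 1 = 1 ∧ (leftScale u A).val 1 1 = -x := by
  have hc : A.val 0 1 ≠ 0 := fun hc => OnePoint.infty_ne_coe _ <|
    linFrac_injective A ((linFrac_infty_eq_infty_iff.2 hc).trans hx.symm)
  have hd : A.val 1 1 = -(x * A.val 0 1) :=
    eq_neg_of_add_eq_zero_right (linFrac_coe_eq_infty_iff.1 hx)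
  refine ⟨Units.mk0 _ (inv_ne_zero hc), ?_⟩
  simp [leftScale_apply, hd, hc, Quaternion.coe_commutes x]

theorem exists_leftScale_of_linFrac_infty_eq_infty
    (h : linFrac A OnePoint.infty = OnePoint.infty) :
    ∃ u, (leftScale u A).val 0 1 = 0 ∧ (leftScale u A).val 1 1 = 1 := by
  have hd : A.val 1 1 ≠ 0 := fun hd => by
    have h0 : linFrac A (0 : ℍ[ℝ]) = OnePoint.infty := by simp [linFrac_coe_eq_infty_iff, hd]
    exact OnePoint.coe_ne_infty _ (linFrac_injective A (h0.trans h.symm))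
  refine ⟨Units.mk0 _ (inv_ne_zero hd), ?_⟩
  simp [leftScale_apply, linFrac_infty_eq_infty_iff.1 h, hd]

theorem hasPoleAt_of_eq_inv_mul_add {p a b : ℍ[ℝ]} (ha : a ≠ 0)
    (h : ∀ q, q ≠ p → q ∈ Ω ∧ f q = (q - p)⁻¹ * a + b) : HasPoleAt Ω f p := by
  intro I _ _
  refine ⟨1, fun n => if n = -1 then a else if n = 0 then b else 0, 1,
    ⟨one_pos, fun z _ hz _ => ⟨(h z hz).1, ?_⟩⟩, fun m hm => ?_, 1, one_pos, by simpa using ha⟩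
  · have hsum := hasSum_sum_of_ne_finset_zero (s := {-1, 0}) (L := .unconditional ℤ)
      (f := fun n : ℤ => (z - p) ^ n * if n = -1 then a else if n = 0 then b else 0)
      (by simp +contextual)
    simpa [(h z hz).2] using hsum
  · dsimp only
    rw [if_neg (by lia), if_neg (by lia)]

theorem regFrac_of_isSelfAdjoint (hc : IsSelfAdjoint (A.val 0 1)) (hd : IsSelfAdjoint (A.val 1 1))
    {q : ℍ[ℝ]} (hq : q * A.val 0 1 + A.val 1 1 ≠ 0) :
    q ∈ regFracDomain A ∧
      regFrac A q = (q * A.val 0 1 + A.val 1 1)⁻¹ * (q * A.val 0 0 + A.val 1 0) := by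
  have hmem := (mem_regFracDomain_iff_of_isSelfAdjoint hc hd).2 hq
  refine ⟨hmem, OnePoint.coe_injective ?_⟩
  rw [coe_regFrac_of_commute (commute_of_isSelfAdjoint hc) (commute_of_isSelfAdjoint hd) hmem,
    linFrac_coe hq]

theorem hasPoleAt_regFrac_iff {x : ℝ} :
    HasPoleAt (regFracDomain A) (regFrac A) x ↔ linFrac A (x : ℍ[ℝ]) = OnePoint.infty := by
  refine ⟨linFrac_coe_eq_infty_of_hasPoleAt, fun hx => ?_⟩
  obtain ⟨u, hc, hd⟩ := exists_leftScale_of_linFrac_coe_eq_infty hx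
  rw [← regFrac_leftScale u, ← regFracDomain_leftScale u]
  set B := leftScale u A
  have hden (q : ℍ[ℝ]) : q * B.val 0 1 + B.val 1 1 = q - x := by
    rw [hc, hd, mul_one, sub_eq_add_neg]
  have hres : x * B.val 0 0 + B.val 1 0 ≠ 0 := fun h =>
    vecMul_ne_zero B (homogCoord_ne_zero (x : ℍ[ℝ])) <| by
      rw [homogCoord_coe_vecMul, hden, sub_self, h]; simp
  refine hasPoleAt_of_eq_inv_mul_add hres (b := B.val 0 0) fun q hq => ?_
  have hq' : q - x ≠ 0 := sub_ne_zero.2 hq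
  obtain ⟨hmem, hval⟩ := regFrac_of_isSelfAdjoint (A := B) (q := q) (by simp [hc])
    (by simp [hd, IsSelfAdjoint]) (by rwa [hden])
  have hnum : q * B.val 0 0 + B.val 1 0 = (q - x) * B.val 0 0 + (x * B.val 0 0 + B.val 1 0) := by
    noncomm_ring
  exact ⟨hmem, by rw [hval, hden, hnum, mul_add, inv_mul_cancel_left₀ hq', add_comm]⟩

theorem hasPoleAtInfty_regFrac_iff :
    HasPoleAtInfty (regFracDomain A) (regFrac A) ↔ linFrac A OnePoint.infty = OnePoint.infty := by
  refine ⟨linFrac_infty_eq_infty_of_hasPoleAtInfty, fun h => ?_⟩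
  obtain ⟨u, hc, hd⟩ := exists_leftScale_of_linFrac_infty_eq_infty h
  rw [← regFrac_leftScale u, ← regFracDomain_leftScale u]
  set B := leftScale u A
  have hlead : B.val 0 0 ≠ 0 := fun h =>
    vecMul_ne_zero B (homogCoord_ne_zero OnePoint.infty) <| by
      rw [homogCoord_infty_vecMul, h, hc]; simp
  refine hasPoleAt_of_eq_inv_mul_add hlead (b := B.val 1 0) fun q hq => ?_
  obtain ⟨hmem, hval⟩ := regFrac_of_isSelfAdjoint (A := B) (q := q⁻¹) (by simp [hc]) (by simp [hd])
    (by simp [hc, hd])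
  exact ⟨⟨hq, hmem⟩, by simp [hval, hc, hd]⟩

theorem eventually_mem_regFracDomain (hc : IsSelfAdjoint (A.val 0 1))
    (hd : IsSelfAdjoint (A.val 1 1)) (q : ℍ[ℝ]) : ∀ᶠ p in 𝓝[≠] q, p ∈ regFracDomain A := by
  have hsub : {p : ℍ[ℝ] | linFrac A p = OnePoint.infty}.Subsingleton := fun p hp p' hp' =>
    OnePoint.coe_injective (linFrac_injective A (hp.trans hp'.symm))
  filter_upwards [nhdsNE_le_cofinite q hsub.finite.compl_mem_cofinite] with p hp
  exact (mem_regFracDomain_iff_of_isSelfAdjoint hc hd).2 (linFrac_coe_eq_infty_iff.not.1 hp)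

theorem IsRegFracWithRealPole.exists_extends_linFrac (hf : IsRegularOn Ω f)
    (h : IsRegFracWithRealPole Ω f) : ∃ B : GL2H,
      IsSelfAdjoint (B.val 0 1) ∧ IsSelfAdjoint (B.val 1 1) ∧ Extends Ω f (linFrac B) := by
  obtain ⟨A, hA, hpole⟩ := h
  obtain ⟨u, hc, hd⟩ : ∃ u, IsSelfAdjoint ((leftScale u A).val 0 1) ∧
      IsSelfAdjoint ((leftScale u A).val 1 1) := by
    rcases hpole with ⟨x, hx⟩ | hinf
    · obtain ⟨u, hc, hd⟩ :=
        exists_leftScale_of_linFrac_coe_eq_infty (hasPoleAt_regFrac_iff.1 hx)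
      exact ⟨u, by simp [hc], by simp [hd, IsSelfAdjoint]⟩
    · obtain ⟨u, hc, hd⟩ :=
        exists_leftScale_of_linFrac_infty_eq_infty (hasPoleAtInfty_regFrac_iff.1 hinf)
      exact ⟨u, by simp [hc], by simp [hd]⟩
  refine ⟨leftScale u A, hc, hd, fun q hq => ?_⟩
  have hlin : ContinuousAt (fun p : ℍ[ℝ] => linFrac (leftScale u A) p) q :=
    ((continuous_linFrac _).comp OnePoint.continuous_coe).continuousAt
  have hfq : ContinuousAt (fun p => (f p : OnePoint ℍ[ℝ])) q :=
    OnePoint.continuous_coe.continuousAt.comp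
      (hf.differentiable.continuousOn.continuousAt (hf.isOpen.mem_nhds hq))
  refine tendsto_nhds_unique_of_eventuallyEq (hlin.mono_left nhdsWithin_le_nhds)
    (hfq.mono_left nhdsWithin_le_nhds) (l := 𝓝[≠] q) ?_
  filter_upwards [eventually_mem_regFracDomain hc hd q,
    mem_nhdsWithin_of_mem_nhds (hf.isOpen.mem_nhds hq)] with p hp hpΩ
  rw [← coe_regFrac_of_commute (commute_of_isSelfAdjoint hc) (commute_of_isSelfAdjoint hd) hp,
    regFrac_leftScale, hA p ⟨hpΩ, by rwa [regFracDomain_leftScale] at hp⟩]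

theorem isRegFracWithRealPole_iff (hf : IsRegularOn Ω f) :
    IsRegFracWithRealPole Ω f ↔ ∃ B : GL2H,
      IsSelfAdjoint (B.val 0 1) ∧ IsSelfAdjoint (B.val 1 1) ∧ Extends Ω f (linFrac B) := by
  refine ⟨fun h => h.exists_extends_linFrac hf, fun ⟨B, hc, hd, hext⟩ => ⟨B, ?_, ?_⟩⟩
  · exact fun q hq => OnePoint.coe_injective <| (hext q hq.1).symm.trans
      (coe_regFrac_of_commute (commute_of_isSelfAdjoint hc) (commute_of_isSelfAdjoint hd) hq.2).symm
  · rw [hasPoleAtInfty_regFrac_iff, linFrac_infty_eq_infty_iff]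
    by_cases hc0 : B.val 0 1 = 0
    · exact .inr hc0
    · refine .inl ⟨-(B.val 1 1).re / (B.val 0 1).re, hasPoleAt_regFrac_iff.2 ?_⟩
      rw [Quaternion.star_eq_self.1 hc, ← Quaternion.coe_zero, Quaternion.coe_inj] at hc0
      rw [linFrac_coe_eq_infty_iff, Quaternion.star_eq_self.1 hc, Quaternion.star_eq_self.1 hd]
      simp only [Quaternion.re_coe, ← Quaternion.coe_mul, ← Quaternion.coe_add]
      rw [div_mul_cancel₀ _ hc0, neg_add_cancel, Quaternion.coe_zero]

end RealPole

section FinitePart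

/-- The quaternion underlying a point of `ℍ ∪ {∞}`, with junk value `0` at `∞`. -/
def finitePart (p : OnePoint ℍ[ℝ]) : ℍ[ℝ] := p.elim 0 id

@[simp] theorem finitePart_coe (q : ℍ[ℝ]) : finitePart q = q := rfl

theorem coe_finitePart {p : OnePoint ℍ[ℝ]} (hp : p ≠ OnePoint.infty) :
    (finitePart p : OnePoint ℍ[ℝ]) = p := by
  obtain ⟨q, rfl⟩ := OnePoint.ne_infty_iff_exists.1 hp
  rfl

theorem continuousAt_finitePart {p : OnePoint ℍ[ℝ]} (hp : p ≠ OnePoint.infty) :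
    ContinuousAt finitePart p := by
  obtain ⟨q, rfl⟩ := OnePoint.ne_infty_iff_exists.1 hp
  rw [ContinuousAt, OnePoint.nhds_coe_eq, tendsto_map'_iff]
  exact tendsto_id

end FinitePart

/-- A self-map of `ℍ ∪ {∞}` is slice regular if its restriction to each complex line is holomorphic
at the finite points where it is finite. Nothing is required at the points sent to `∞`, nor at `∞`
itself: the notion is only used for continuous maps. -/
def IsSliceRegularMap (φ : OnePoint ℍ[ℝ] → OnePoint ℍ[ℝ]) : Prop :=
  ∀ (I : imagUnits) (z : ℂ), φ (sliceEmb I z) ≠ OnePoint.infty →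
    HolomorphicAt I (fun w => finitePart (φ (sliceEmb I w))) z

/-- A real matrix whose linear fractional transformation is `q ↦ x + q⁻¹`, used to move a pole from
the real point `x` to `∞`. -/
def realInversion (x : ℝ) : GL2H where
  val := !![x, 1; 1, 0]
  inv := !![0, 1; 1, -x]
  val_inv := by ext1 i j; fin_cases i <;> fin_cases j <;> simp
  inv_val := by ext1 i j; fin_cases i <;> fin_cases j <;> simp

theorem linFrac_realInversion_coe {q : ℍ[ℝ]} (hq : q ≠ 0) (x : ℝ) :
    linFrac (realInversion x) q = (x + q⁻¹ : ℍ[ℝ]) := by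
  rw [linFrac_coe (by simpa [realInversion] using hq)]
  simp [realInversion, mul_add, hq]

theorem linFrac_realInversion_infty (x : ℝ) :
    linFrac (realInversion x) OnePoint.infty = (x : ℍ[ℝ]) := by
  rw [linFrac_eq_homogRatio, homogCoord_infty_vecMul, homogRatio_of_ne_zero] <;>
    simp [realInversion]

/-- The matrix of the affine transformation `q ↦ q * a + b`. -/
def affineMatrix (a : ℍ[ℝ]ˣ) (b : ℍ[ℝ]) : GL2H where
  val := !![a, 0; b, 1]
  inv := !![a⁻¹, 0; -(b * a⁻¹), 1]
  val_inv := by ext1 i j; fin_cases i <;> fin_cases j <;> simp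
  inv_val := by ext1 i j; fin_cases i <;> fin_cases j <;> simp

theorem linFrac_affineMatrix_coe (a : ℍ[ℝ]ˣ) (b q : ℍ[ℝ]) :
    linFrac (affineMatrix a b) q = (q * a + b : ℍ[ℝ]) := by
  rw [linFrac_coe] <;> simp [affineMatrix]

section SliceRegularMap

variable {φ : OnePoint ℍ[ℝ] → OnePoint ℍ[ℝ]}

theorem continuous_comp_sliceEmb (hφ : Continuous φ) (I : imagUnits) :
    Continuous fun z => φ (sliceEmb I z) :=
  hφ.comp (OnePoint.continuous_coe.comp (isometry_sliceEmb I).continuous)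

theorem continuousAt_finitePart_comp_sliceEmb (hφ : Continuous φ) {I : imagUnits} {z : ℂ}
    (hz : φ (sliceEmb I z) ≠ OnePoint.infty) :
    ContinuousAt (fun w => finitePart (φ (sliceEmb I w))) z :=
  (continuousAt_finitePart hz).tendsto.comp (continuous_comp_sliceEmb hφ I).continuousAt

theorem isSliceRegularMap_of_extends {Ω : Set ℍ[ℝ]} {f : ℍ[ℝ] → ℍ[ℝ]} (hf : IsRegularOn Ω f)
    (hΩ : ∀ I : imagUnits, sliceEmb I ⁻¹' Ω ∈ codiscrete ℂ) (hφ : Continuous φ)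
    (hext : Extends Ω f φ) : IsSliceRegularMap φ := by
  intro I z hz
  refine holomorphicAt_of_punctured ?_ (continuousAt_finitePart_comp_sliceEmb hφ hz)
  have hmem : sliceEmb I ⁻¹' Ω ∈ 𝓝[≠] z := by
    simpa using mem_codiscreteWithin_iff_forall_mem_nhdsNE.1 (hΩ I) z (Set.mem_univ z)
  filter_upwards [hmem] with w hw
  refine (hf.holomorphicAt hw).congr_of_eventuallyEq ?_
  filter_upwards [(isometry_sliceEmb I).continuous.continuousAt.eventually
    (hf.isOpen.mem_nhds hw)] with v hv
  rw [hext _ hv, finitePart_coe, Function.comp_apply]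

theorem IsSliceRegularMap.comp_realInversion (hreg : IsSliceRegularMap φ) (hφ : Continuous φ)
    (x : ℝ) : IsSliceRegularMap (φ ∘ linFrac (realInversion x)) := by
  have hslice (I : imagUnits) {w : ℂ} (hw : w ≠ 0) :
      linFrac (realInversion x) (sliceEmb I w) = (sliceEmb I (x + w⁻¹) : ℍ[ℝ]) := by
    rw [linFrac_realInversion_coe ((map_ne_zero _).2 hw), map_add, map_inv₀, sliceEmb_ofReal]
  have hcont := hφ.comp (continuous_linFrac (realInversion x))
  intro I z hz
  refine holomorphicAt_of_punctured ?_ (continuousAt_finitePart_comp_sliceEmb hcont hz)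
  filter_upwards [((continuous_comp_sliceEmb hcont I).continuousAt.eventually_ne hz).filter_mono
    nhdsWithin_le_nhds, nhdsNE_le_cofinite z (Set.finite_singleton 0).compl_mem_cofinite]
    with w hw hw0
  rw [Function.comp_apply, hslice I hw0] at hw
  refine ((hreg I _ hw).comp (u := fun w => x + w⁻¹)
    ((differentiableAt_inv hw0).const_add _)).congr_of_eventuallyEq ?_
  filter_upwards [isOpen_ne.mem_nhds hw0] with v hv
  simp only [Function.comp_apply, hslice I hv]

theorem IsSliceRegularMap.exists_eq_linFrac_affineMatrix (hreg : IsSliceRegularMap φ)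
    (hφ : Continuous φ) (hinj : Function.Injective φ) (h : φ OnePoint.infty = OnePoint.infty) :
    ∃ a b, φ = linFrac (affineMatrix a b) := by
  have hfin (q : ℍ[ℝ]) : φ q ≠ OnePoint.infty := fun hq =>
    OnePoint.coe_ne_infty q (hinj (hq.trans h.symm))
  have hlim : Tendsto (fun q : ℍ[ℝ] => finitePart (φ q)) (cobounded ℍ[ℝ]) (cobounded ℍ[ℝ]) := by
    rw [← tendsto_coe_nhds_infty_iff]
    simp only [coe_finitePart (hfin _)]
    simpa only [h, Function.comp_def, id] using
      (hφ.tendsto _).comp (tendsto_coe_nhds_infty_iff.2 tendsto_id)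
  have hinj' : Function.Injective fun q : ℍ[ℝ] => finitePart (φ q) := fun p q hpq =>
    OnePoint.coe_injective <| hinj <| by
      rw [← coe_finitePart (hfin p), ← coe_finitePart (hfin q)]
      exact congrArg _ hpq
  obtain ⟨a, b, ha, hab⟩ := exists_eq_mul_add_of_injective hinj' (fun I z => hreg I z (hfin _)) hlim
  refine ⟨Units.mk0 a ha, b, funext fun p => ?_⟩
  cases p with
  | infty => rw [h, linFrac_infty_eq_infty_iff.2 rfl]
  | coe q => rw [linFrac_affineMatrix_coe, Units.val_mk0, ← hab, coe_finitePart (hfin q)]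

theorem IsSliceRegularMap.exists_coe_eq_infty (hreg : IsSliceRegularMap φ) (hφ : Continuous φ)
    (hinj : Function.Injective φ) (h : φ OnePoint.infty ≠ OnePoint.infty) :
    ∃ p : ℍ[ℝ], φ p = OnePoint.infty := by
  by_contra! hfin
  have hlim : Tendsto (fun z => finitePart (φ (sliceEmb unitI z))) (cobounded ℂ)
      (𝓝 (finitePart (φ OnePoint.infty))) :=
    (continuousAt_finitePart h).tendsto.comp <| (hφ.tendsto _).comp <|
      tendsto_coe_nhds_infty_iff.2 (isometry_sliceEmb unitI).antilipschitz.tendsto_cobounded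
  have hconst := eq_of_tendsto_cobounded (fun z => hreg unitI z (hfin _)) hlim
  have hφ01 : φ (sliceEmb unitI 0) = φ (sliceEmb unitI 1) := by
    rw [← coe_finitePart (hfin _), hconst 0, ← hconst 1, coe_finitePart (hfin _)]
  exact zero_ne_one <| (isometry_sliceEmb unitI).injective <| OnePoint.coe_injective <| hinj hφ01

theorem IsSliceRegularMap.eventually_representation_formula (hreg : IsSliceRegularMap φ)
    {I : imagUnits} {z₀ : ℂ} (hfin : ∀ q : ℍ[ℝ], q ≠ sliceEmb I z₀ → φ q ≠ OnePoint.infty)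
    (J : imagUnits) : ∀ᶠ z in 𝓝[≠] z₀, φ (sliceEmb I z) =
      (2⁻¹ * ((1 - I * J) * finitePart (φ (sliceEmb J z)) +
        (1 + I * J) * finitePart (φ (sliceEmb (-J) z))) : ℍ[ℝ]) := by
  have := algebraRat.charZero ℍ[ℝ]
  have hfinite : ({z₀, conj z₀} : Set ℂ).Finite := Set.toFinite _
  have hconn : IsPreconnected ({z₀, conj z₀}ᶜ : Set ℂ) :=
    (hfinite.countable.isPathConnected_compl_of_one_lt_rank
      (by simp [Complex.rank_real_complex])).isConnected.isPreconnected
  have hx₀ : ((z₀.re + 1 : ℝ) : ℂ) ∈ ({z₀, conj z₀}ᶜ : Set ℂ) := by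
    rintro (h | h) <;> simpa using congrArg Complex.re h
  filter_upwards [nhdsNE_le_cofinite z₀ hfinite.compl_mem_cofinite, self_mem_nhdsWithin]
    with z hz hz₀
  rw [← representation_formula (F := fun q => finitePart (φ q)) hfinite.isClosed.isOpen_compl
    hconn hx₀ (fun K w hw => hreg K w <| hfin _ fun h => hw (eq_or_eq_conj_of_sliceEmb_eq h)) I J
    hz, inv_mul_cancel_left₀ two_ne_zero, coe_finitePart]
  exact hfin _ ((isometry_sliceEmb I).injective.ne hz₀)

/-- If the complex line of `J` avoided `p`, the representation formula would keep `φ` finite at `p`,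
approached along another complex line. -/
theorem IsSliceRegularMap.mem_range_sliceEmb_of_eq_infty (hreg : IsSliceRegularMap φ)
    (hφ : Continuous φ) (hinj : Function.Injective φ) {p : ℍ[ℝ]} (hp : φ p = OnePoint.infty)
    (J : imagUnits) : p ∈ Set.range (sliceEmb J) := by
  by_contra hpJ
  obtain ⟨I, z₀, rfl⟩ := exists_sliceEmb_eq p
  have hfin (q : ℍ[ℝ]) (hq : q ≠ sliceEmb I z₀) : φ q ≠ OnePoint.infty := fun h =>
    hq (OnePoint.coe_injective (hinj (h.trans hp.symm)))
  have hJ (z : ℂ) : φ (sliceEmb J z) ≠ OnePoint.infty := hfin _ fun h => hpJ ⟨z, h⟩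
  have hJ' (z : ℂ) : φ (sliceEmb (-J) z) ≠ OnePoint.infty := by
    rw [sliceEmb_neg]
    exact hJ _
  have hlim : ContinuousAt (fun z => 2⁻¹ * ((1 - I * J) * finitePart (φ (sliceEmb J z)) +
      (1 + I * J) * finitePart (φ (sliceEmb (-J) z)))) z₀ :=
    .const_mul (((continuousAt_finitePart_comp_sliceEmb hφ (hJ z₀)).const_mul _).add
      ((continuousAt_finitePart_comp_sliceEmb hφ (hJ' z₀)).const_mul _)) _
  exact OnePoint.infty_ne_coe _ <| hp.symm.trans <| tendsto_nhds_unique_of_eventuallyEq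
    ((continuous_comp_sliceEmb hφ I).continuousAt.mono_left nhdsWithin_le_nhds)
    ((OnePoint.continuous_coe.continuousAt.comp hlim).mono_left nhdsWithin_le_nhds)
    (hreg.eventually_representation_formula hfin J)

theorem coe_re_eq_of_forall_mem_range_sliceEmb {p : ℍ[ℝ]}
    (hp : ∀ J : imagUnits, p ∈ Set.range (sliceEmb J)) : (p.re : ℍ[ℝ]) = p := by
  obtain ⟨z, hz⟩ := hp unitI
  obtain ⟨w, hw⟩ := hp unitJ
  rw [sliceEmb_apply] at hz hw
  have hunitJ : (unitJ : ℍ[ℝ]).imI = 0 := rfl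
  have hI : p.imI = 0 := by simp [← hw, hunitJ]
  have hJ : p.imJ = 0 := by simp [← hz]
  have hK : p.imK = 0 := by simp [← hz]
  ext <;> simp [hI, hJ, hK]

theorem IsSliceRegularMap.exists_eq_linFrac (hreg : IsSliceRegularMap φ) (hφ : Continuous φ)
    (hinj : Function.Injective φ) : ∃ B : GL2H,
      IsSelfAdjoint (B.val 0 1) ∧ IsSelfAdjoint (B.val 1 1) ∧ φ = linFrac B := by
  by_cases hinf : φ OnePoint.infty = OnePoint.infty
  · obtain ⟨a, b, h⟩ := hreg.exists_eq_linFrac_affineMatrix hφ hinj hinf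
    exact ⟨affineMatrix a b, by simp [affineMatrix], by simp [affineMatrix], h⟩
  obtain ⟨p, hp⟩ := hreg.exists_coe_eq_infty hφ hinj hinf
  have hreal := coe_re_eq_of_forall_mem_range_sliceEmb
    (hreg.mem_range_sliceEmb_of_eq_infty hφ hinj hp)
  let M := realInversion p.re
  obtain ⟨a, b, h⟩ := (hreg.comp_realInversion hφ p.re).exists_eq_linFrac_affineMatrix
    (hφ.comp (continuous_linFrac M)) (hinj.comp (linFrac_injective M)) (by
      rw [Function.comp_apply, linFrac_realInversion_infty, hreal, hp])
  refine ⟨M⁻¹ * affineMatrix a b, ?_, ?_, funext fun q => ?_⟩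
  · simp [M, realInversion, affineMatrix]
  · simp [M, realInversion, affineMatrix, IsSelfAdjoint]
  · rw [linFrac_mul, ← h, Function.comp_apply, ← linFrac_mul, inv_mul_cancel, linFrac_one]

end SliceRegularMap

end

end SliceRegular

theorem corollary6p4_general (Ω : Set ℍ[ℝ]) (f : ℍ[ℝ] → ℍ[ℝ]) (hf : SliceRegular.IsRegularOn Ω f)
    (hΩ : ∀ I : SliceRegular.imagUnits, SliceRegular.sliceEmb I ⁻¹' Ω ∈ Filter.codiscrete ℂ) :
    List.TFAE [
      ∃ φ : OnePoint ℍ[ℝ] ≃ₜ OnePoint ℍ[ℝ], SliceRegular.Extends Ω f φ,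
      ∃ φ : OnePoint ℍ[ℝ] → OnePoint ℍ[ℝ],
        Continuous φ ∧ Function.Injective φ ∧ SliceRegular.Extends Ω f φ,
      SliceRegular.IsRegFracWithRealPole Ω f,
      SliceRegular.MemRegFrac Ω f ∧ SliceRegular.MemLinFrac Ω f] := by
  tfae_have 1 → 2 := fun ⟨φ, hext⟩ => ⟨φ, φ.continuous, φ.injective, hext⟩
  tfae_have 2 → 3
  | ⟨φ, hφ, hinj, hext⟩ => by
    obtain ⟨B, hc, hd, rfl⟩ :=
      (SliceRegular.isSliceRegularMap_of_extends hf hΩ hφ hext).exists_eq_linFrac hφ hinj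
    exact (SliceRegular.isRegFracWithRealPole_iff hf).2 ⟨B, hc, hd, hext⟩
  tfae_have 3 → 4
  | h => by
    obtain ⟨B, -, -, hext⟩ := h.exists_extends_linFrac hf
    exact ⟨⟨h.choose, h.choose_spec.1⟩, B, hext⟩
  tfae_have 4 → 1 := fun ⟨_, B, hext⟩ => ⟨SliceRegular.linFracHomeomorph B, hext⟩
  tfae_finish

theorem corollary6p4 (Ω : Set ℍ[ℝ]) (f : ℍ[ℝ] → ℍ[ℝ])
    (hf : SliceRegular.IsSemiregular Ω f) :
    List.TFAE [
      ∃ φ : OnePoint ℍ[ℝ] ≃ₜ OnePoint ℍ[ℝ], SliceRegular.Extends Ω f φ,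
      ∃ φ : OnePoint ℍ[ℝ] → OnePoint ℍ[ℝ],
        Continuous φ ∧ Function.Injective φ ∧ SliceRegular.Extends Ω f φ,
      SliceRegular.IsRegFracWithRealPole Ω f,
      SliceRegular.MemRegFrac Ω f ∧ SliceRegular.MemLinFrac Ω f] :=
  corollary6p4_general Ω f hf.isRegularOn hf.preimage_mem_codiscrete
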